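/- Let $n\in\mathbb N$ and let $x_1,\dots,x_n$ be a semicircular or a circular system of bounded operators on a complex Hilbert space $H$, in Voiculescu's sense: - $x_1,\dots,x_n\in B(H)$ is a *semicircular system* if the $x_k$ are selfadjoint and there is a faithful state $\varphi$ on the $C^*$-algebra $C^*(1,x_1,\dots,x_n)\subset B(H)$ such that (i) the unital algebras generated by $x_1$, …, by $x_n$ are free with respect to $\varphi$, that is, $\varphi(a_1\cdots a_p)=0$ whenever $p\ge 1$, each $a_j$ is a polynomial in $x_{i_j}$ with $\varphi(a_j)=0$, and $i_1\ne i_2\ne\cdots\ne i_p$; and (ii) each $x_k$ has the semicircle law on $[-1,1]$, that is, $\varphi(x_k^p)=\frac2\pi\int_{-1}^1t^p\sqrt{1-t^2}\,dt$ for all integers $p\ge 0$. - $x_1,\dots,x_n\in B(H)$ is a *circular system* if $x_k=\frac1{\sqrt2}(a_k+ib_k)$ for all $k$, where $(a_1,\dots,a_n,b_1,\dots,b_n)$ is a semicircular system in $B(H)$. Let $(e_{ij})$ be the matrix units of $M_n=M_n(\mathbb C)$, let $\delta_k=e_{k1}\oplus e_{1k}\in M_n\oplus M_n$ and let $E_n=\operatorname{span}\{\delta_1,\dots,\delta_n\}\subset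 M_n\oplus M_n$, where $M_n\oplus M_n$ is regarded as the block diagonal subalgebra of $M_{2n}=B(\ell_2^{2n})$. For a linear map $u\colon E\to F$ between linear subspaces $E\subset B(\mathcal H)$ and $F\subset B(\mathcal K)$ let $$\|u\|_{cb}=\sup_{m}\ \sup\bigl\{\|(u(a_{ij}))_{i,j\le m}\|_{B(\ell_2^m(\mathcal K))}\ :\ a_{ij}\in E,\ \|(a_{ij})_{i,j\le m}\|_{B(\ell_2^m(\mathcal H))}\le 1\bigr\}.$$ Then $$u\colon\ \sum_{k=1}^n c_k\delta_k\longmapsto\sum_{k=1}^n c_kx_k,\qquad c_1,\dots,c_n\in\mathbb C,$$ is a well-defined linear bijection from $E_n$ onto $\operatorname{span}\{x_1,\dots,x_n\}\subset B(H)$, and $$\|u\|_{cb}\,\|u^{-1}\|_{cb}\le 2 .$$ -/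

import Mathlib

open scoped ComplexOrder

noncomputable section

/-! ### Operator spaces and completely bounded norms -/

/-- The operator on the Hilbert sum `ℓ²_m(H)` given by an `m × m` matrix of operators on `H`. -/
def matrixOp {H : Type*} [NormedAddCommGroup H] [InnerProductSpace ℂ H] {m : ℕ}
    (a : Matrix (Fin m) (Fin m) (H →L[ℂ] H)) :
    PiLp 2 (fun _ : Fin m => H) →L[ℂ] PiLp 2 (fun _ : Fin m => H) :=
  ((PiLp.continuousLinearEquiv 2 ℂ (fun _ : Fin m => H)).symm :
      (Fin m → H) →L[ℂ] PiLp 2 (fun _ : Fin m => H)) ∘L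
    ContinuousLinearMap.pi
      (fun i => ∑ j, a i j ∘L PiLp.proj (𝕜 := ℂ) 2 (fun _ : Fin m => H) j)

theorem matrixOp_apply {H : Type*} [NormedAddCommGroup H] [InnerProductSpace ℂ H] {m : ℕ}
    (a : Matrix (Fin m) (Fin m) (H →L[ℂ] H)) (v : PiLp 2 (fun _ : Fin m => H)) (i : Fin m) :
    matrixOp a v i = ∑ j, a i j (v j) := by
  simp [matrixOp]

/-- The completely bounded norm of a linear map `u : E → F` between operator spaces
`E ⊆ B(H)` and `F ⊆ B(K)`: the supremum over `m` of the norms of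
`(a i j) ↦ (u (a i j))` as a map from `M_m(E) ⊆ B(ℓ²_m(H))` to `M_m(F) ⊆ B(ℓ²_m(K))`.
It is `⊤` if `u` is not completely bounded. -/
def cbNorm {H K : Type*} [NormedAddCommGroup H] [InnerProductSpace ℂ H]
    [NormedAddCommGroup K] [InnerProductSpace ℂ K]
    {E : Submodule ℂ (H →L[ℂ] H)} {F : Submodule ℂ (K →L[ℂ] K)} (u : E →ₗ[ℂ] F) :
    ENNReal :=
  ⨆ (m : ℕ) (a : Matrix (Fin m) (Fin m) E)
    (_ : ‖matrixOp (fun i j => (a i j : H →L[ℂ] H))‖ ≤ 1),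
    ‖matrixOp (fun i j => (u (a i j) : K →L[ℂ] K))‖ₑ

/-- The element `δ_k = e_{k1} ⊕ e_{1k}` of `M_n ⊕ M_n`, embedded block diagonally in
`M_{2n} = B(ℓ²_{2n})`. -/
def rowColDelta (n : ℕ) (k : Fin n) :
    EuclideanSpace ℂ (Fin n ⊕ Fin n) →L[ℂ] EuclideanSpace ℂ (Fin n ⊕ Fin n) :=
  Matrix.toEuclideanCLM (n := Fin n ⊕ Fin n) (𝕜 := ℂ)
    (Matrix.fromBlocks (Matrix.single k ⟨0, k.pos⟩ 1) 0 0 (Matrix.single ⟨0, k.pos⟩ k 1))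

/-- The operator space `E_n ⊆ M_n ⊕ M_n ⊆ B(ℓ²_{2n})`, the linear span of
`δ_1, …, δ_n`. -/
def rowColSpace (n : ℕ) :
    Submodule ℂ (EuclideanSpace ℂ (Fin n ⊕ Fin n) →L[ℂ] EuclideanSpace ℂ (Fin n ⊕ Fin n)) :=
  Submodule.span ℂ (Set.range (rowColDelta n))

/-- `δ_k` as an element of `E_n`. -/
def rowColBasis (n : ℕ) (k : Fin n) : rowColSpace n :=
  ⟨rowColDelta n k, Submodule.subset_span (Set.mem_range_self k)⟩

/-! ### Free probability -/

section FreeProbability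

/-- A faithful state on a unital `*`-algebra (applied below to a unital C*-algebra). -/
structure IsFaithfulState {A : Type*} [Ring A] [StarRing A] [Algebra ℂ A]
    (φ : A →ₗ[ℂ] ℂ) : Prop where
  map_one : φ 1 = 1
  nonneg : ∀ a, 0 ≤ φ (star a * a)
  faithful : ∀ a, φ (star a * a) = 0 → a = 0

/-- Freeness of a family of unital subalgebras `B i` with respect to `φ`:
`φ (a_1 ⋯ a_p) = 0` whenever `p ≥ 1`, `a_j ∈ B (i_j)`, `φ (a_j) = 0` and
`i_1 ≠ i_2 ≠ ⋯ ≠ i_p` (consecutive indices differ). -/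
def IsFreeFamily {ι A : Type*} [Ring A] [Algebra ℂ A] (φ : A →ₗ[ℂ] ℂ)
    (B : ι → Subalgebra ℂ A) : Prop :=
  ∀ l : List (ι × A), l ≠ [] → (l.map Prod.fst).IsChain (· ≠ ·) →
    (∀ q ∈ l, q.2 ∈ B q.1 ∧ φ q.2 = 0) → φ (l.map Prod.snd).prod = 0

/-- `a` has, with respect to `φ`, the centered semicircular distribution on `[-1, 1]`, i.e. the
law with density `(2 / π) √(1 - t²)`. -/
def HasSemicircleLaw {A : Type*} [Ring A] [Algebra ℂ A] (φ : A →ₗ[ℂ] ℂ) (a : A) : Prop :=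
  ∀ p : ℕ, φ (a ^ p) =
    ((∫ t in (-1 : ℝ)..1, t ^ p * (2 / Real.pi * Real.sqrt (1 - t ^ 2)) : ℝ) : ℂ)

/-- A free family of selfadjoint elements each of which has the semicircle law. (As the elements
are selfadjoint, the unital algebra generated by one of them is a `*`-algebra.) -/
structure IsSemicircularFamily {ι A : Type*} [Ring A] [StarRing A] [Algebra ℂ A]
    (φ : A →ₗ[ℂ] ℂ) (x : ι → A) : Prop where
  selfAdjoint : ∀ k, IsSelfAdjoint (x k)
  free : IsFreeFamily φ (fun k => Algebra.adjoin ℂ {x k})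
  law : ∀ k, HasSemicircleLaw φ (x k)

variable {ι H : Type*} [NormedAddCommGroup H] [InnerProductSpace ℂ H] [CompleteSpace H]

/-- `C*(1, (x_k)_k) ⊆ B(H)`. -/
def generatedCStar (x : ι → H →L[ℂ] H) : StarSubalgebra ℂ (H →L[ℂ] H) :=
  (StarAlgebra.adjoin ℂ (Set.range x)).topologicalClosure

theorem mem_generatedCStar (x : ι → H →L[ℂ] H) (k : ι) : x k ∈ generatedCStar x :=
  StarSubalgebra.le_topologicalClosure _
    (StarAlgebra.subset_adjoin ℂ (Set.range x) (Set.mem_range_self k))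

/-- A semicircular system of operators on a Hilbert space: the C*-algebra generated by the
operators and `1` carries a faithful state for which they form a semicircular family. -/
def IsSemicircularSystem (x : ι → H →L[ℂ] H) : Prop :=
  ∃ φ : generatedCStar x →ₗ[ℂ] ℂ, IsFaithfulState φ ∧
    IsSemicircularFamily φ (fun k => (⟨x k, mem_generatedCStar x k⟩ : generatedCStar x))

/-- A circular system of operators on a Hilbert space: `y_k = (a_k + i b_k) / √2`, where the
`a_k` and `b_k` together form a semicircular system. -/
def IsCircularSystem (y : ι → H →L[ℂ] H) : Prop :=
  ∃ a b : ι → H →L[ℂ] H, IsSemicircularSystem (Sum.elim a b) ∧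
    ∀ k, y k = ((Real.sqrt 2 : ℂ)⁻¹) • (a k + Complex.I • b k)

end FreeProbability

end

open scoped ComplexOrder

noncomputable section

/-! ### Chebyshev polynomials and the semicircle law -/

/-! For matrix coefficients `α k`, the norm of `∑ α k ⊗ δ_k` is the larger of the column norm `‖∑ (α
k)* α k‖^{1/2}` and the row norm `‖∑ α k (α k)*‖^{1/2}`, because the two diagonal blocks act
separately. It suffices to show that `‖∑ α k ⊗ x k‖` lies between half of this maximum and the
maximum itself; this gives `‖u‖_cb ≤ 1` and `‖u⁻¹‖_cb ≤ 2`.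

In a semicircular system, `x k` acts by left multiplication as `(l_k + l_k*) / 2`, with `l_k` the
creation operators of the full Fock space (`mul_wordMap`). The vectors `e_w` are realised by
Chebyshev words, which freeness and the semicircle law make orthonormal for `φ (a* b)`
(`apply_star_chebyshevWord_mul`). For the upper bound, `∑ α k ⊗ l_k` is controlled by the column
norm, `∑ α k ⊗ l_k*` by the row norm, and the operator is the average of the two. For the lower
bound, applying it to the vacuum produces half of the column, and applying it to words of length one
and reading off the vacuum component produces half of the row.

Bounds on the Fock side and operator norms on `H` are exchanged by `columnNormSq_le` (positivity of
`φ`) and `norm_matrixOp_sq_le` (faithfulness of `φ`), so the GNS space is never constructed.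

A circular system with coefficients `α` is a semicircular one with coefficients `α k / √2` and `i α
k / √2`, and this substitution preserves both column and row bounds. -/

theorem integral_chebyshevU_mul_sqrt {n : ℕ} (hn : n ≠ 0) :
    ∫ t in (-1 : ℝ)..1, (Polynomial.Chebyshev.U ℝ n).eval t * Real.sqrt (1 - t ^ 2) = 0 := by
  open Polynomial Polynomial.Chebyshev in
  -- Writing `√(1 - t²) = (1 - t²) / √(1 - t²)` turns the integral into one of first-kind
  -- polynomials against the arcsine weight, where they are orthogonal. At `t = ±1` both sides
  -- vanish, since `0⁻¹ = 0`.
  have h : ∀ t ∈ Set.uIcc (-1 : ℝ) 1, (U ℝ n).eval t * Real.sqrt (1 - t ^ 2) =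
      ((T ℝ 1).eval t * (T ℝ (n + 1)).eval t - (T ℝ (n + 2)).eval t) *
        (Real.sqrt (1 - t ^ 2)⁻¹) := by
    intro t ht
    rw [Set.uIcc_of_le (by norm_num)] at ht
    have h0 : 0 ≤ 1 - t ^ 2 := by nlinarith [ht.1, ht.2]
    have h1 := congrArg (Polynomial.eval t) (one_sub_X_sq_mul_U_eq_pol_in_T ℝ n)
    simp only [eval_mul, eval_sub, eval_one, eval_pow, eval_X] at h1
    simp only [T_one, eval_X]
    rw [← h1, Real.sqrt_inv]
    rcases h0.eq_or_lt with h2 | h2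
    · simp [← h2]
    · have h3 := Real.sqrt_pos.2 h2
      field_simp
      rw [Real.sq_sqrt h0]
  rw [intervalIntegral.integral_congr h, ← integral_measureT
    (fun t => (T ℝ 1).eval t * (T ℝ (n + 1)).eval t - (T ℝ (n + 2)).eval t),
    MeasureTheory.integral_sub (integrable_measureT (by fun_prop))
      (integrable_measureT (by fun_prop)),
    integral_eval_T_real_mul_eval_T_real_measureT,
    integral_eval_T_real_measureT_of_ne_zero (by omega),
    integral_eval_T_real_measureT_of_ne_zero (by omega),
    integral_eval_T_real_measureT_of_ne_zero (by omega)]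
  simp

theorem HasSemicircleLaw.apply_aeval_map {A : Type*} [Ring A] [Algebra ℂ A] {φ : A →ₗ[ℂ] ℂ}
    {a : A} (h : HasSemicircleLaw φ a) (p : Polynomial ℝ) :
    φ (Polynomial.aeval a (p.map (algebraMap ℝ ℂ))) =
      ((∫ t in (-1 : ℝ)..1, p.eval t * (2 / Real.pi * Real.sqrt (1 - t ^ 2)) : ℝ) : ℂ) := by
  induction p using Polynomial.induction_on' with
  | add p q hp hq =>
    simp only [Polynomial.map_add, map_add, hp, hq, Polynomial.eval_add, add_mul]
    rw [intervalIntegral.integral_add, Complex.ofReal_add] <;>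
    · apply Continuous.intervalIntegrable
      fun_prop
  | monomial n c =>
    simp only [Polynomial.map_monomial, Polynomial.aeval_monomial, Polynomial.eval_monomial,
      mul_assoc]
    rw [← Algebra.smul_def, map_smul, h n, intervalIntegral.integral_const_mul]
    simp

theorem HasSemicircleLaw.apply_aeval_chebyshevU {A : Type*} [Ring A] [Algebra ℂ A]
    {φ : A →ₗ[ℂ] ℂ} {a : A} (h : HasSemicircleLaw φ a) {n : ℕ} (hn : n ≠ 0) :
    φ (Polynomial.aeval a (Polynomial.Chebyshev.U ℂ n)) = 0 := by
  rw [← Polynomial.Chebyshev.map_U (algebraMap ℝ ℂ), h.apply_aeval_map]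
  have h1 : ∀ t : ℝ, (Polynomial.Chebyshev.U ℝ n).eval t * (2 / Real.pi * Real.sqrt (1 - t ^ 2)) =
      2 / Real.pi * ((Polynomial.Chebyshev.U ℝ n).eval t * Real.sqrt (1 - t ^ 2)) := by
    intro t; ring
  simp only [h1]
  rw [intervalIntegral.integral_const_mul, integral_chebyshevU_mul_sqrt hn]
  simp

/-! ### Noncommutative Chebyshev words -/

section Words

variable {ι A : Type*} [DecidableEq ι] [Ring A]

/-- The noncommutative Chebyshev polynomials (of the second kind) in the variables `x k`,
indexed by words. They correspond to the standard basis of the full Fock space. -/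
def chebyshevWord (x : ι → A) : List ι → A
  | [] => 1
  | [k] => 2 * x k
  | k :: l :: w => 2 * x k * chebyshevWord x (l :: w) - if k = l then chebyshevWord x w else 0

@[simp] theorem chebyshevWord_nil (x : ι → A) : chebyshevWord x [] = 1 := by
  simp [chebyshevWord]

theorem chebyshevWord_cons_cons (x : ι → A) (k l : ι) (w : List ι) :
    chebyshevWord x (k :: l :: w) = 2 * x k * chebyshevWord x (l :: w) -
      if k = l then chebyshevWord x w else 0 := by
  rw [chebyshevWord]

theorem two_mul_mul_chebyshevWord_nil (x : ι → A) (k : ι) :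
    2 * x k * chebyshevWord x [] = chebyshevWord x [k] := by
  simp [chebyshevWord]

theorem two_mul_mul_chebyshevWord_cons (x : ι → A) (k l : ι) (w : List ι) :
    2 * x k * chebyshevWord x (l :: w) =
      chebyshevWord x (k :: l :: w) + if k = l then chebyshevWord x w else 0 := by
  rw [chebyshevWord_cons_cons]; abel

theorem chebyshevWord_cons_of_head?_ne (x : ι → A) {k : ι} {w : List ι} (h : w.head? ≠ some k) :
    chebyshevWord x (k :: w) = 2 * x k * chebyshevWord x w := by
  cases w with
  | nil => simp [chebyshevWord]
  | cons l w =>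
    have : k ≠ l := fun h' => h (by simp [h'])
    simp [chebyshevWord_cons_cons, this]

variable [Algebra ℂ A]

/-- The word recursion on a repeated letter is the recurrence `U_{n+2} = 2 X U_{n+1} - U_n`; since
`w` does not start with `k`, no correction term arises where the block meets `w`. -/
theorem chebyshevWord_replicate_append (x : ι → A) {k : ι} {w : List ι}
    (h : w.head? ≠ some k) (n : ℕ) :
    chebyshevWord x (List.replicate n k ++ w) =
      Polynomial.aeval (x k) (Polynomial.Chebyshev.U ℂ n) * chebyshevWord x w := by
  induction n using Nat.twoStepInduction with
  | zero => simp
  | one => simp [chebyshevWord_cons_of_head?_ne x h, map_ofNat]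
  | more n h0 h1 =>
    have e : ((n + 2 : ℕ) : ℤ) = (n : ℤ) + 2 := by push_cast; ring
    rw [List.replicate_succ, List.replicate_succ, List.cons_append, List.cons_append,
      chebyshevWord_cons_cons, if_pos rfl, h0, e, Polynomial.Chebyshev.U_add_two,
      ← List.cons_append, ← List.replicate_succ, h1]
    simp [sub_mul, mul_assoc, map_ofNat]

/-- Decomposition into maximal constant blocks. Storing the length minus one makes every block
nonempty, so its Chebyshev polynomial has positive degree and is centered. -/
theorem List.exists_flatMap_replicate (w : List ι) :
    ∃ b : List (ι × ℕ), (b.map Prod.fst).IsChain (· ≠ ·) ∧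
      w = b.flatMap fun q => List.replicate (q.2 + 1) q.1 := by
  induction w with
  | nil => exact ⟨[], by simp⟩
  | cons k w ih =>
    obtain ⟨b, hb, rfl⟩ := ih
    rcases b with _ | ⟨⟨l, n⟩, b⟩
    · exact ⟨[(k, 0)], by simp⟩
    · by_cases hkl : k = l
      · subst hkl
        exact ⟨(k, n + 1) :: b, by simpa using hb, by simp [List.replicate_succ]⟩
      · refine ⟨(k, 0) :: (l, n) :: b, ?_, by simp [List.replicate_succ]⟩
        simp only [List.map_cons, List.isChain_cons_cons] at hb ⊢
        exact ⟨hkl, hb⟩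

theorem chebyshevWord_flatMap_replicate (x : ι → A) {b : List (ι × ℕ)}
    (hb : (b.map Prod.fst).IsChain (· ≠ ·)) :
    chebyshevWord x (b.flatMap fun q => List.replicate (q.2 + 1) q.1) =
      (b.map fun q =>
        Polynomial.aeval (x q.1) (Polynomial.Chebyshev.U ℂ ((q.2 + 1 : ℕ) : ℤ))).prod := by
  induction b with
  | nil => simp
  | cons q b ih =>
    rw [List.flatMap_cons, chebyshevWord_replicate_append, ih, List.map_cons, List.prod_cons]
    · rw [List.map_cons] at hb
      exact hb.tail
    · rcases b with _ | ⟨r, b⟩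
      · simp
      · simp only [List.map_cons, List.isChain_cons_cons] at hb
        simpa [List.replicate_succ] using hb.1.symm

variable [StarRing A]

/-- A nonempty word is an alternating product of centered elements, one for each block, so freeness
applies. -/
theorem IsSemicircularFamily.apply_chebyshevWord {φ : A →ₗ[ℂ] ℂ} {x : ι → A}
    (hx : IsSemicircularFamily φ x) (h1 : φ 1 = 1) (w : List ι) :
    φ (chebyshevWord x w) = if w = [] then 1 else 0 := by
  obtain ⟨b, hb, rfl⟩ := List.exists_flatMap_replicate w
  rw [chebyshevWord_flatMap_replicate x hb]
  by_cases hb0 : b = []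
  · simp [hb0, h1]
  · have hne : (b.flatMap fun q => List.replicate (q.2 + 1) q.1) ≠ [] := by
      obtain ⟨q, b, rfl⟩ := List.exists_cons_of_ne_nil hb0
      simp
    rw [if_neg hne]
    have := hx.free (b.map fun q =>
      (q.1, Polynomial.aeval (x q.1) (Polynomial.Chebyshev.U ℂ ((q.2 + 1 : ℕ) : ℤ))))
      (by simpa using hb0) (by simpa [Function.comp_def] using hb) ?_
    · simpa [Function.comp_def] using this
    · intro q hq
      obtain ⟨r, -, rfl⟩ := List.mem_map.1 hq
      exact ⟨Polynomial.aeval_mem_adjoin_singleton _ _,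
        (hx.law r.1).apply_aeval_chebyshevU (Nat.succ_ne_zero _)⟩

/-- Selfadjointness moves the first letter of `v` onto `w`, where the recursion either lengthens or
shortens the word; induction on `v` reduces to the value of `φ` on a single word. -/
theorem IsSemicircularFamily.apply_star_chebyshevWord_mul {φ : A →ₗ[ℂ] ℂ} {x : ι → A}
    (hx : IsSemicircularFamily φ x) (h1 : φ 1 = 1) (v w : List ι) :
    φ (star (chebyshevWord x v) * chebyshevWord x w) = if v = w then 1 else 0 := by
  have hs (k : ι) (a : A) : star (2 * x k * a) = star a * (2 * x k) := by
    have h2 : (2 : A) = 1 + 1 := by norm_num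
    rw [star_mul, star_mul, (hx.selfAdjoint k).star_eq, h2, star_add, star_one, mul_add, add_mul,
      mul_one, one_mul]
  have key := hx.apply_chebyshevWord h1
  induction v using List.twoStepInduction generalizing w with
  | nil => simp [key, eq_comm]
  | singleton k =>
    rw [← two_mul_mul_chebyshevWord_nil, hs]
    simp only [chebyshevWord_nil, star_one, one_mul]
    cases w with
    | nil => rw [two_mul_mul_chebyshevWord_nil, key]
    | cons l w =>
      rw [two_mul_mul_chebyshevWord_cons, map_add, key, apply_ite φ, key, map_zero]
      by_cases hkl : k = l <;> simp [hkl, eq_comm]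
  | cons_cons k l v ih0 ih1 =>
    rw [chebyshevWord_cons_cons, star_sub, hs, sub_mul, mul_assoc, map_sub, apply_ite star,
      ite_mul, apply_ite φ, ih0, star_zero, zero_mul, map_zero]
    cases w with
    | nil =>
      rw [two_mul_mul_chebyshevWord_nil, ih1]
      by_cases hkl : k = l <;> simp [hkl, eq_comm]
    | cons j w =>
      rw [two_mul_mul_chebyshevWord_cons, mul_add, map_add, ih1, mul_ite, apply_ite φ, ih1,
        mul_zero, map_zero]
      by_cases hkl : k = l <;> by_cases hkj : k = j <;> by_cases hvw : v = w <;> simp_all <;> grind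

end Words

/-! ### Creation and annihilation operators on finitely supported functions on words -/

section Fock

variable {ι : Type*}

theorem tsum_list_eq [Fintype ι] {s : List ι → ℝ} (hs : Summable s) :
    ∑' w, s w = s [] + ∑ k, ∑' w, s (k :: w) := by
  let e : Unit ⊕ ι × List ι ≃ List ι :=
    { toFun := Sum.elim (fun _ => []) fun p => p.1 :: p.2
      invFun := fun w => match w with
        | [] => Sum.inl ()
        | k :: w => Sum.inr (k, w)
      left_inv := by rintro (_ | ⟨k, w⟩) <;> rfl
      right_inv := by rintro (_ | ⟨k, w⟩) <;> rfl }
  have h2 : Summable fun p : ι × List ι => s (e (Sum.inr p)) :=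
    hs.comp_injective (e.injective.comp Sum.inr_injective)
  have h3 : HasSum (fun o => s (e o)) (s [] + ∑' p : ι × List ι, s (e (Sum.inr p))) :=
    HasSum.sum (hasSum_unique _) h2.hasSum
  rw [← e.tsum_eq, h3.tsum_eq, h2.tsum_prod, tsum_fintype]
  rfl

/-- The creation operator `e_w ↦ e_{kw}`. -/
def creation (k : ι) : (List ι →₀ ℂ) →ₗ[ℂ] (List ι →₀ ℂ) :=
  Finsupp.lmapDomain ℂ ℂ (List.cons k)

/-- The annihilation operator `e_{kw} ↦ e_w`, the adjoint of the creation operator. -/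
def annihilation (k : ι) : (List ι →₀ ℂ) →ₗ[ℂ] (List ι →₀ ℂ) :=
  Finsupp.lcomapDomain (List.cons k) (List.cons_injective)

theorem annihilation_apply (k : ι) (f : List ι →₀ ℂ) (w : List ι) :
    annihilation k f w = f (k :: w) := rfl

theorem creation_single (k : ι) (w : List ι) (c : ℂ) :
    creation k (Finsupp.single w c) = Finsupp.single (k :: w) c := by
  simp [creation]

theorem creation_apply_nil (k : ι) (f : List ι →₀ ℂ) : creation k f [] = 0 := by
  rw [creation, Finsupp.lmapDomain_apply, Finsupp.mapDomain_of_notMem_range]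
  simp

theorem creation_apply_cons [DecidableEq ι] (k l : ι) (f : List ι →₀ ℂ) (w : List ι) :
    creation k f (l :: w) = if k = l then f w else 0 := by
  split_ifs with h
  · subst h
    exact Finsupp.mapDomain_apply List.cons_injective f w
  · rw [creation, Finsupp.lmapDomain_apply, Finsupp.mapDomain_of_notMem_range]
    simp [h]

theorem annihilation_single_nil (k : ι) (c : ℂ) :
    annihilation k (Finsupp.single [] c) = 0 := by
  ext w
  simp [annihilation_apply]

theorem annihilation_single_cons [DecidableEq ι] (k l : ι) (w : List ι) (c : ℂ) :
    annihilation k (Finsupp.single (l :: w) c) = if k = l then Finsupp.single w c else 0 := by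
  ext v
  by_cases h : k = l <;> simp [annihilation_apply, Finsupp.single_apply, h, eq_comm]

/-! ### Left multiplication by the generators as creation plus annihilation -/

section Algebra

variable {A : Type*} [DecidableEq ι] [Ring A] [Algebra ℂ A]

/-- The linear map from the algebraic Fock space sending `e_w` to the Chebyshev word `U_w`. -/
def wordMap (x : ι → A) : (List ι →₀ ℂ) →ₗ[ℂ] A :=
  Finsupp.linearCombination ℂ (chebyshevWord x)

@[simp] theorem wordMap_single (x : ι → A) (w : List ι) (c : ℂ) :
    wordMap x (Finsupp.single w c) = c • chebyshevWord x w := by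
  simp [wordMap]

theorem mul_wordMap (x : ι → A) (k : ι) (f : List ι →₀ ℂ) :
    x k * wordMap x f = wordMap x ((2⁻¹ : ℂ) • (creation k f + annihilation k f)) := by
  have h2 (a : A) : x k * a = (2⁻¹ : ℂ) • (2 * x k * a) := by
    rw [mul_assoc, two_mul, ← two_smul ℂ, smul_smul]; norm_num
  induction f using Finsupp.induction_linear with
  | zero => simp
  | add f g hf hg =>
    rw [map_add, mul_add, hf, hg, ← map_add, ← smul_add, map_add, map_add]
    congr 2
    abel
  | single w c =>
    rw [wordMap_single, mul_smul_comm, h2, map_smul, map_add, creation_single]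
    cases w with
    | nil =>
      rw [two_mul_mul_chebyshevWord_nil, annihilation_single_nil, map_zero, add_zero,
        wordMap_single, smul_comm]
    | cons l w =>
      rw [two_mul_mul_chebyshevWord_cons, annihilation_single_cons, apply_ite (wordMap x),
        wordMap_single, wordMap_single, map_zero, smul_comm, smul_add, smul_ite, smul_zero]

theorem exists_wordMap_eq_of_mem_adjoin (x : ι → A) {a : A}
    (ha : a ∈ Algebra.adjoin ℂ (Set.range x)) : ∃ f, wordMap x f = a := by
  -- The range contains `1` and is stable under left multiplication by each generator; this form of
  -- the claim passes through products.
  suffices h : ∀ g, ∃ f, wordMap x f = a * wordMap x g by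
    obtain ⟨f, hf⟩ := h (Finsupp.single [] 1)
    exact ⟨f, by simpa using hf⟩
  induction ha using Algebra.adjoin_induction with
  | mem a ha =>
    obtain ⟨k, rfl⟩ := ha
    exact fun g => ⟨_, (mul_wordMap x k g).symm⟩
  | algebraMap c => exact fun g => ⟨c • g, by rw [map_smul, Algebra.smul_def]⟩
  | add a b _ _ ha hb =>
    intro g
    obtain ⟨f₁, h₁⟩ := ha g
    obtain ⟨f₂, h₂⟩ := hb g
    exact ⟨f₁ + f₂, by rw [map_add, h₁, h₂, add_mul]⟩
  | mul a b _ _ ha hb =>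
    intro g
    obtain ⟨f₁, h₁⟩ := hb g
    obtain ⟨f₂, h₂⟩ := ha f₁
    exact ⟨f₂, by rw [h₂, h₁, mul_assoc]⟩

end Algebra

/-! ### The `ℓ²`-norm on words and its agreement with the state -/

section NormSq

variable {κ : Type*} [Fintype κ]

/-- The squared `ℓ²`-norm of a finitely supported vector valued function on words. -/
def wordNormSq (F : κ → List ι →₀ ℂ) : ℝ := ∑' w, ∑ i, ‖F i w‖ ^ 2

theorem summable_norm_sq (F : κ → List ι →₀ ℂ) : Summable fun w => ∑ i, ‖F i w‖ ^ 2 := by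
  refine summable_sum fun i _ => summable_of_hasFiniteSupport ?_
  refine (F i).hasFiniteSupport.subset fun w hw => ?_
  contrapose! hw
  simpa using hw

theorem wordNormSq_eq [Fintype ι] (F : κ → List ι →₀ ℂ) :
    wordNormSq F = ∑ i, ‖F i []‖ ^ 2 + ∑ k, wordNormSq fun i => annihilation k (F i) :=
  tsum_list_eq (summable_norm_sq F)

theorem sum_norm_sq_le_wordNormSq (F : κ → List ι →₀ ℂ) (w : List ι) :
    ∑ i, ‖F i w‖ ^ 2 ≤ wordNormSq F :=
  (summable_norm_sq F).le_tsum w fun _ _ => by positivity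

theorem wordNormSq_single [DecidableEq ι] (w : List ι) (v : κ → ℂ) :
    wordNormSq (fun i => Finsupp.single w (v i)) = ∑ i, ‖v i‖ ^ 2 := by
  rw [wordNormSq, tsum_eq_single w]
  · simp
  · intro w' hw
    simp [hw.symm]

theorem wordNormSq_smul (c : ℂ) (F : κ → List ι →₀ ℂ) :
    wordNormSq (fun i => c • F i) = ‖c‖ ^ 2 * wordNormSq F := by
  simp only [wordNormSq, Finsupp.smul_apply, norm_smul, mul_pow, ← Finset.mul_sum, tsum_mul_left]

theorem wordNormSq_add_le (F G : κ → List ι →₀ ℂ) :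
    wordNormSq (fun i => F i + G i) ≤ 2 * (wordNormSq F + wordNormSq G) := by
  rw [wordNormSq, wordNormSq, wordNormSq, ← (summable_norm_sq F).tsum_add (summable_norm_sq G),
    ← tsum_mul_left]
  refine (summable_norm_sq fun i => F i + G i).tsum_le_tsum (fun w => ?_)
    (((summable_norm_sq F).add (summable_norm_sq G)).mul_left 2)
  rw [← Finset.sum_add_distrib, Finset.mul_sum]
  refine Finset.sum_le_sum fun i _ => ?_
  have h := norm_add_le (F i w) (G i w)
  rw [Finsupp.add_apply]
  nlinarith [norm_nonneg (F i w + G i w), sq_nonneg (‖F i w‖ - ‖G i w‖)]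

theorem IsSemicircularFamily.sum_apply_star_wordMap_mul {A : Type*} [DecidableEq ι] [Ring A]
    [StarRing A] [Algebra ℂ A] [StarModule ℂ A] {φ : A →ₗ[ℂ] ℂ} {x : ι → A}
    (hx : IsSemicircularFamily φ x) (h1 : φ 1 = 1) (F : κ → List ι →₀ ℂ) :
    ∑ i, φ (star (wordMap x (F i)) * wordMap x (F i)) = (wordNormSq F : ℂ) := by
  have h (f : List ι →₀ ℂ) : φ (star (wordMap x f) * wordMap x f) =
      ((∑' w, ‖f w‖ ^ 2 : ℝ) : ℂ) := by
    rw [tsum_eq_sum (s := f.support) (by intro w hw; simpa using hw)]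
    simp only [wordMap, Finsupp.linearCombination_apply, Finsupp.sum, star_sum, Finset.sum_mul_sum,
      map_sum, star_smul, smul_mul_smul_comm, map_smul, hx.apply_star_chebyshevWord_mul h1,
      smul_eq_mul, mul_ite, mul_one, mul_zero]
    push_cast
    refine Finset.sum_congr rfl fun w hw => ?_
    rw [Finset.sum_ite_eq, if_pos hw]
    exact Complex.conj_mul' (f w)
  simp only [h]
  rw [← Complex.ofReal_sum, wordNormSq, Summable.tsum_finsetSum]
  intro i _
  simpa using summable_norm_sq fun _ : Unit => F i

end NormSq

/-! ### Row and column bounds versus the action on Fock space -/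

section MatrixAction

variable {κ : Type*} [Fintype κ] [Fintype ι]

/-- The action of `∑ k, α k ⊗ x k` in the Fock space picture. -/
def fockAction (α : ι → Matrix κ κ ℂ) (F : κ → List ι →₀ ℂ) (i : κ) : List ι →₀ ℂ :=
  ∑ k, ∑ j, α k i j • (2⁻¹ : ℂ) • (creation k (F j) + annihilation k (F j))

theorem wordMap_fockAction {A : Type*} [DecidableEq ι] [Ring A] [Algebra ℂ A] (x : ι → A)
    (α : ι → Matrix κ κ ℂ) (F : κ → List ι →₀ ℂ) (i : κ) :
    wordMap x (fockAction α F i) = ∑ k, ∑ j, α k i j • (x k * wordMap x (F j)) := by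
  simp only [fockAction, map_sum, mul_wordMap]
  simp only [map_smul]

/-- The column norm of `(α k)_k` is at most `√c`. -/
def ColumnBound (α : ι → Matrix κ κ ℂ) (c : ℝ) : Prop :=
  ∀ v : κ → ℂ, ∑ k, ∑ i, ‖∑ j, α k i j * v j‖ ^ 2 ≤ c * ∑ j, ‖v j‖ ^ 2

/-- The row norm of `(α k)_k` is at most `√c`. -/
def RowBound (α : ι → Matrix κ κ ℂ) (c : ℝ) : Prop :=
  ∀ y : ι → κ → ℂ, ∑ i, ‖∑ k, ∑ j, α k i j * y k j‖ ^ 2 ≤ c * ∑ k, ∑ j, ‖y k j‖ ^ 2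

/-- The creation operators have orthogonal ranges, so the squared norm splits over the first letter
`k`, and the column bound applies at each remaining word `w`. -/
theorem ColumnBound.wordNormSq_le {α : ι → Matrix κ κ ℂ} {c : ℝ} (hα : ColumnBound α c)
    (F : κ → List ι →₀ ℂ) :
    wordNormSq (fun i => ∑ k, ∑ j, α k i j • creation k (F j)) ≤ c * wordNormSq F := by
  classical
  have h0 (k : ι) (w : List ι) (i : κ) :
      annihilation k (∑ l, ∑ j, α l i j • creation l (F j)) w = ∑ j, α k i j * F j w := by
    simp only [annihilation_apply, Finsupp.finsetSum_apply, Finsupp.smul_apply,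
      creation_apply_cons, smul_eq_mul]
    rw [Finset.sum_eq_single k]
    · simp
    · intro l _ hl; simp [hl]
    · simp
  rw [wordNormSq_eq]
  simp only [Finsupp.finsetSum_apply, Finsupp.smul_apply, creation_apply_nil, smul_zero,
    Finset.sum_const_zero, norm_zero]
  simp only [wordNormSq, ne_eq, OfNat.ofNat_ne_zero, not_false_eq_true, zero_pow,
    Finset.sum_const_zero, zero_add]
  have h1 (k : ι) := summable_norm_sq fun i => annihilation k (∑ l, ∑ j, α l i j • creation l (F j))
  rw [← Summable.tsum_finsetSum fun k _ => h1 k, ← tsum_mul_left]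
  refine (summable_sum fun k _ => h1 k).tsum_le_tsum (fun w => ?_)
    ((summable_norm_sq F).mul_left c)
  simp only [h0]
  exact hα _

/-- At each `w` the row bound is applied to the family `F j (k :: w)`; together these exhaust all
coordinates of `F` except the vacuum one, which is discarded. -/
theorem RowBound.wordNormSq_le {α : ι → Matrix κ κ ℂ} {c : ℝ} (hc : 0 ≤ c) (hα : RowBound α c)
    (F : κ → List ι →₀ ℂ) :
    wordNormSq (fun i => ∑ k, ∑ j, α k i j • annihilation k (F j)) ≤ c * wordNormSq F := by
  have h1 (k : ι) := summable_norm_sq fun i => annihilation k (F i)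
  calc _ ≤ c * ∑ k, wordNormSq fun i => annihilation k (F i) := by
        simp only [wordNormSq]
        rw [← Summable.tsum_finsetSum fun k _ => h1 k, ← tsum_mul_left]
        refine (summable_norm_sq _).tsum_le_tsum (fun w => ?_)
          ((summable_sum fun k _ => h1 k).mul_left c)
        simpa [annihilation_apply, Finsupp.finsetSum_apply] using hα fun k j => F j (k :: w)
    _ ≤ _ := by
        rw [wordNormSq_eq F]
        gcongr
        exact le_add_of_nonneg_left (by positivity)

theorem fockAction_eq (α : ι → Matrix κ κ ℂ) (F : κ → List ι →₀ ℂ) (i : κ) :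
    fockAction α F i = (2⁻¹ : ℂ) • (∑ k, ∑ j, α k i j • creation k (F j) +
      ∑ k, ∑ j, α k i j • annihilation k (F j)) := by
  simp only [fockAction, smul_add, Finset.sum_add_distrib, Finset.smul_sum, smul_comm (2⁻¹ : ℂ)]

theorem wordNormSq_fockAction_le {α : ι → Matrix κ κ ℂ} {c : ℝ} (hc : 0 ≤ c)
    (h₁ : ColumnBound α c) (h₂ : RowBound α c) (F : κ → List ι →₀ ℂ) :
    wordNormSq (fockAction α F) ≤ c * wordNormSq F := by
  have h := wordNormSq_add_le (fun i => ∑ k, ∑ j, α k i j • creation k (F j))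
    (fun i => ∑ k, ∑ j, α k i j • annihilation k (F j))
  have e : fockAction α F = fun i => (2⁻¹ : ℂ) • (∑ k, ∑ j, α k i j • creation k (F j) +
      ∑ k, ∑ j, α k i j • annihilation k (F j)) := funext (fockAction_eq α F)
  rw [e, wordNormSq_smul]
  have h3 := h₁.wordNormSq_le F
  have h4 := h₂.wordNormSq_le hc F
  norm_num
  linarith

/-- Test on vacuum vectors: the coordinate at `[k]` is half of `α k` applied to `v`. Squaring that
half accounts for the 4. -/
theorem columnBound_of_wordNormSq_fockAction_le {α : ι → Matrix κ κ ℂ} {c : ℝ}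
    (h : ∀ F, wordNormSq (fockAction α F) ≤ c * wordNormSq F) : ColumnBound α (4 * c) := by
  classical
  intro v
  have h1 := h fun j => Finsupp.single [] (v j)
  rw [wordNormSq_single, wordNormSq_eq] at h1
  have h2 (k : ι) : 4⁻¹ * ∑ i, ‖∑ j, α k i j * v j‖ ^ 2 ≤
      wordNormSq fun i => annihilation k (fockAction α (fun j => Finsupp.single [] (v j)) i) := by
    refine le_of_eq_of_le ?_ (sum_norm_sq_le_wordNormSq _ [])
    rw [Finset.mul_sum]
    refine Finset.sum_congr rfl fun i _ => ?_
    simp only [fockAction_eq, annihilation_apply, Finsupp.finsetSum_apply, Finsupp.smul_apply,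
      Finsupp.add_apply, creation_apply_cons, smul_eq_mul, Finsupp.single_apply]
    rw [Finset.sum_eq_single k]
    · simp [mul_pow]; norm_num
    · intro l _ hl; simp [hl]
    · simp
  have h3 := Finset.sum_le_sum fun k (_ : k ∈ Finset.univ) => h2 k
  rw [← Finset.mul_sum] at h3
  have h4 : 0 ≤ ∑ i, ‖fockAction α (fun j => Finsupp.single [] (v j)) i []‖ ^ 2 := by positivity
  linarith

theorem rowBound_of_wordNormSq_fockAction_le {α : ι → Matrix κ κ ℂ} {c : ℝ}
    (h : ∀ F, wordNormSq (fockAction α F) ≤ c * wordNormSq F) : RowBound α (4 * c) := by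
  classical
  intro y
  -- Only annihilation reaches the vacuum coordinate, so on words of length one that coordinate is
  -- half of the row applied to `y`.
  let F : κ → List ι →₀ ℂ := fun j => ∑ k, Finsupp.single [k] (y k j)
  have hF0 (j : κ) : F j [] = 0 := by simp [F, Finsupp.finsetSum_apply]
  have hF1 (j : κ) (k : ι) (w : List ι) : F j (k :: w) = if w = [] then y k j else 0 := by
    simp only [F, Finsupp.finsetSum_apply, Finsupp.single_apply]
    by_cases hw : w = []
    · simp [hw]
    · simp [hw, Ne.symm hw]
  have hF : wordNormSq F = ∑ k, ∑ j, ‖y k j‖ ^ 2 := by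
    rw [wordNormSq_eq]
    simp only [hF0, norm_zero, ne_eq, OfNat.ofNat_ne_zero, not_false_eq_true, zero_pow,
      Finset.sum_const_zero, zero_add]
    refine Finset.sum_congr rfl fun k _ => ?_
    rw [← wordNormSq_single ([] : List ι)]
    congr 1
    ext j w
    simp [annihilation_apply, hF1, Finsupp.single_apply, eq_comm]
  have h1 := (sum_norm_sq_le_wordNormSq _ []).trans (h F)
  have h2 : ∑ i, ‖fockAction α F i []‖ ^ 2 = 4⁻¹ * ∑ i, ‖∑ k, ∑ j, α k i j * y k j‖ ^ 2 := by
    rw [Finset.mul_sum]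
    refine Finset.sum_congr rfl fun i _ => ?_
    simp only [fockAction_eq, annihilation_apply, Finsupp.finsetSum_apply, Finsupp.smul_apply,
      Finsupp.add_apply, creation_apply_nil, smul_eq_mul, hF1]
    simp [mul_pow]; norm_num
  rw [h2, hF] at h1
  linarith

end MatrixAction

end Fock

/-! ### Faithful states and norms of operator matrices -/

section BlockOperators

variable {H : Type*} [NormedAddCommGroup H] [InnerProductSpace ℂ H] {m : ℕ}

/-- The inclusion of `H` as the `j`-th summand of `ℓ²_m(H)`. -/
def blockIncl (H : Type*) [NormedAddCommGroup H] [InnerProductSpace ℂ H] {m : ℕ} (j : Fin m) :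
    H →L[ℂ] PiLp 2 (fun _ : Fin m => H) :=
  ((PiLp.continuousLinearEquiv 2 ℂ (fun _ : Fin m => H)).symm :
      (Fin m → H) →L[ℂ] PiLp 2 (fun _ : Fin m => H)) ∘L
    ContinuousLinearMap.single ℂ (fun _ : Fin m => H) j

theorem blockIncl_apply (j i : Fin m) (v : H) :
    blockIncl H j v i = if i = j then v else 0 := by
  simp [blockIncl]

/-- The `(i, j)` entry of an operator on `ℓ²_m(H)`. -/
def blockEntry (i j : Fin m)
    (Y : PiLp 2 (fun _ : Fin m => H) →L[ℂ] PiLp 2 (fun _ : Fin m => H)) : H →L[ℂ] H :=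
  PiLp.proj (𝕜 := ℂ) 2 (fun _ : Fin m => H) i ∘L Y ∘L blockIncl H j

theorem blockEntry_apply (i j : Fin m)
    (Y : PiLp 2 (fun _ : Fin m => H) →L[ℂ] PiLp 2 (fun _ : Fin m => H)) (v : H) :
    blockEntry i j Y v = Y (blockIncl H j v) i := rfl

theorem continuous_blockEntry (i j : Fin m) : Continuous (blockEntry (H := H) i j) := by
  unfold blockEntry
  fun_prop

theorem sum_blockIncl (v : PiLp 2 (fun _ : Fin m => H)) : ∑ j, blockIncl H j (v j) = v := by
  ext i
  simp [blockIncl_apply]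

theorem blockEntry_matrixOp (a : Matrix (Fin m) (Fin m) (H →L[ℂ] H)) (i j : Fin m) :
    blockEntry i j (matrixOp a) = a i j := by
  ext v
  rw [blockEntry_apply, matrixOp_apply, Finset.sum_eq_single j]
  · simp [blockIncl_apply]
  · intro k _ hk; simp [blockIncl_apply, hk]
  · simp

theorem blockEntry_mul (i j : Fin m)
    (Y Z : PiLp 2 (fun _ : Fin m => H) →L[ℂ] PiLp 2 (fun _ : Fin m => H)) :
    blockEntry i j (Y * Z) = ∑ k, blockEntry i k Y * blockEntry k j Z := by
  ext v
  simp only [sum_apply, mul_apply_eq_comp, blockEntry_apply]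
  conv_lhs => rw [← sum_blockIncl (Z (blockIncl H j v)), map_sum]
  simp

@[simp] theorem blockEntry_add (i j : Fin m)
    (Y Z : PiLp 2 (fun _ : Fin m => H) →L[ℂ] PiLp 2 (fun _ : Fin m => H)) :
    blockEntry i j (Y + Z) = blockEntry i j Y + blockEntry i j Z := by
  ext v; simp [blockEntry_apply]

@[simp] theorem blockEntry_sub (i j : Fin m)
    (Y Z : PiLp 2 (fun _ : Fin m => H) →L[ℂ] PiLp 2 (fun _ : Fin m => H)) :
    blockEntry i j (Y - Z) = blockEntry i j Y - blockEntry i j Z := by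
  ext v; simp [blockEntry_apply]

@[simp] theorem blockEntry_smul (i j : Fin m) (c : ℂ)
    (Y : PiLp 2 (fun _ : Fin m => H) →L[ℂ] PiLp 2 (fun _ : Fin m => H)) :
    blockEntry i j (c • Y) = c • blockEntry i j Y := by
  ext v; simp [blockEntry_apply]

theorem blockEntry_one (i j : Fin m) :
    blockEntry (H := H) i j 1 = if i = j then 1 else 0 := by
  ext v
  by_cases h : i = j <;> simp [blockEntry_apply, blockIncl_apply, h]

theorem eq_zero_of_blockEntry_eq_zero
    {Y : PiLp 2 (fun _ : Fin m => H) →L[ℂ] PiLp 2 (fun _ : Fin m => H)}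
    (h : ∀ i j, blockEntry i j Y = 0) : Y = 0 := by
  ext v i
  rw [← sum_blockIncl v, map_sum]
  simp [← blockEntry_apply, h]

variable [CompleteSpace H]

theorem blockEntry_star (i j : Fin m)
    (Y : PiLp 2 (fun _ : Fin m => H) →L[ℂ] PiLp 2 (fun _ : Fin m => H)) :
    blockEntry i j (star Y) = star (blockEntry j i Y) := by
  have h (k : Fin m) (v : H) (w : PiLp 2 (fun _ : Fin m => H)) :
      inner ℂ (blockIncl H k v) w = inner ℂ v (w k) := by
    rw [PiLp.inner_apply, Finset.sum_eq_single k]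
    · simp [blockIncl_apply]
    · intro l _ hl; simp [blockIncl_apply, hl]
    · simp
  ext v
  refine ext_inner_left ℂ fun w => ?_
  rw [blockEntry_apply, ← h]
  simp only [ContinuousLinearMap.star_eq_adjoint, ContinuousLinearMap.adjoint_inner_right]
  rw [blockEntry_apply, ← inner_conj_symm, h, inner_conj_symm]

/-- The operators on `ℓ²_m(H)` all of whose entries lie in `S`. -/
def blockStarSubalgebra (S : StarSubalgebra ℂ (H →L[ℂ] H)) (m : ℕ) :
    StarSubalgebra ℂ (PiLp 2 (fun _ : Fin m => H) →L[ℂ] PiLp 2 (fun _ : Fin m => H)) where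
  carrier := {Y | ∀ i j, blockEntry i j Y ∈ S}
  mul_mem' {Y Z} hY hZ i j := by
    rw [blockEntry_mul]
    exact sum_mem fun k _ => mul_mem (hY i k) (hZ k j)
  add_mem' {Y Z} hY hZ i j := by
    rw [blockEntry_add]
    exact add_mem (hY i j) (hZ i j)
  algebraMap_mem' c i j := by
    rw [Algebra.algebraMap_eq_smul_one, blockEntry_smul, blockEntry_one]
    split_ifs
    · exact SMulMemClass.smul_mem c (one_mem S)
    · rw [smul_zero]; exact zero_mem S
  star_mem' {Y} hY i j := by
    rw [blockEntry_star]
    exact star_mem (hY j i)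

theorem mem_blockStarSubalgebra {S : StarSubalgebra ℂ (H →L[ℂ] H)}
    {Y : PiLp 2 (fun _ : Fin m => H) →L[ℂ] PiLp 2 (fun _ : Fin m => H)} :
    Y ∈ blockStarSubalgebra S m ↔ ∀ i j, blockEntry i j Y ∈ S := Iff.rfl

/-- Closedness keeps the continuous functional calculus of a matrix over `S` inside the matrices
over `S`, where `φ` can be applied entrywise. -/
theorem isClosed_blockStarSubalgebra {S : StarSubalgebra ℂ (H →L[ℂ] H)}
    (hS : IsClosed (S : Set (H →L[ℂ] H))) :
    IsClosed (blockStarSubalgebra S m : Set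
      (PiLp 2 (fun _ : Fin m => H) →L[ℂ] PiLp 2 (fun _ : Fin m => H))) := by
  have : (blockStarSubalgebra S m : Set
      (PiLp 2 (fun _ : Fin m => H) →L[ℂ] PiLp 2 (fun _ : Fin m => H))) =
      ⋂ i, ⋂ j, blockEntry i j ⁻¹' (S : Set (H →L[ℂ] H)) := by
    ext Y; simp [mem_blockStarSubalgebra]
  rw [this]
  exact isClosed_iInter fun i => isClosed_iInter fun j => hS.preimage (continuous_blockEntry i j)

end BlockOperators

/-! ### Faithful states detect norms of operator matrices -/

section States

variable {H : Type*} [NormedAddCommGroup H] [InnerProductSpace ℂ H] [CompleteSpace H]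
  {S : StarSubalgebra ℂ (H →L[ℂ] H)} {φ : S →ₗ[ℂ] ℂ}

theorem IsFaithfulState.nonneg_of_nonneg (hφ : IsFaithfulState φ)
    (hS : IsClosed (S : Set (H →L[ℂ] H))) {a : S} (ha : 0 ≤ (a : H →L[ℂ] H)) : 0 ≤ φ a := by
  -- Positivity in `B(H)` gives a square root inside `S`, so `a` has the form `b* b` with `b` in
  -- `S`.
  have hb : cfc Real.sqrt (a : H →L[ℂ] H) ∈ S := cfc_mem (hs := hS) _ a.2
  have hsa : IsSelfAdjoint (cfc Real.sqrt (a : H →L[ℂ] H)) := cfc_predicate _ _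
  have h : cfc Real.sqrt (a : H →L[ℂ] H) * cfc Real.sqrt (a : H →L[ℂ] H) = a := by
    rw [← cfc_mul Real.sqrt Real.sqrt (a : H →L[ℂ] H)]
    conv_rhs => rw [← cfc_id ℝ (a : H →L[ℂ] H) (IsSelfAdjoint.of_nonneg ha)]
    exact cfc_congr fun t ht => Real.mul_self_sqrt (spectrum_nonneg_of_nonneg ha ht)
  have h' : star (⟨_, hb⟩ : S) * ⟨_, hb⟩ = a := Subtype.ext
    ((congrArg (· * cfc Real.sqrt (a : H →L[ℂ] H)) hsa.star_eq).trans h)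
  rw [← h']
  exact hφ.nonneg _

theorem IsFaithfulState.norm_apply_le_of_isSelfAdjoint (hφ : IsFaithfulState φ)
    (hS : IsClosed (S : Set (H →L[ℂ] H))) {a : S} (ha : IsSelfAdjoint (a : H →L[ℂ] H)) :
    ‖φ a‖ ≤ ‖a‖ := by
  have h1 : 0 ≤ φ (((‖a‖ : ℝ) : ℂ) • 1 - a) := hφ.nonneg_of_nonneg hS (by
    have := ha.le_algebraMap_norm_self
    rw [← sub_nonneg] at this
    convert! this using 1)
  have h2 : 0 ≤ φ (((‖a‖ : ℝ) : ℂ) • 1 + a) := hφ.nonneg_of_nonneg hS (by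
    have := ha.neg.le_algebraMap_norm_self
    rw [← sub_nonneg, sub_neg_eq_add, norm_neg] at this
    convert! this using 1)
  rw [map_sub, map_smul, hφ.map_one, Complex.le_def] at h1
  rw [map_add, map_smul, hφ.map_one, Complex.le_def] at h2
  simp at h1 h2
  have h3 : φ a = ((φ a).re : ℂ) := Complex.ext rfl (by simpa using h2.2.symm)
  rw [h3, Complex.norm_real, Real.norm_eq_abs, abs_le]
  change -‖(a : H →L[ℂ] H)‖ ≤ _ ∧ _ ≤ ‖(a : H →L[ℂ] H)‖
  exact ⟨by linarith [h2.1], h1.1⟩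

theorem IsFaithfulState.continuous (hφ : IsFaithfulState φ)
    (hS : IsClosed (S : Set (H →L[ℂ] H))) : Continuous φ := by
  -- The constant 2 comes from bounding real and imaginary parts separately; any finite constant
  -- suffices for continuity.
  refine AddMonoidHomClass.continuous_of_bound φ 2 fun a => ?_
  have h1 : IsSelfAdjoint (((2⁻¹ : ℂ) • (a + star a) : S) : H →L[ℂ] H) := by
    simp [isSelfAdjoint_iff, add_comm]
  have h2 : IsSelfAdjoint (((2⁻¹ * Complex.I : ℂ) • (star a - a) : S) : H →L[ℂ] H) := by
    suffices h : IsSelfAdjoint ((2⁻¹ * Complex.I : ℂ) • (star a - a)) from h.map S.subtype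
    simp only [isSelfAdjoint_iff, star_smul, star_sub, star_star, star_mul', RCLike.star_def,
      Complex.conj_I, map_inv₀, map_ofNat]
    module
  have h3 : a = (2⁻¹ : ℂ) • (a + star a) + Complex.I • (2⁻¹ * Complex.I : ℂ) • (star a - a) := by
    rw [smul_smul, show Complex.I * (2⁻¹ * Complex.I) = -2⁻¹ by
      rw [mul_left_comm, Complex.I_mul_I]; ring]
    module
  have hn : ‖star a‖ = ‖a‖ := norm_star (a : H →L[ℂ] H)
  have n1 : ‖(2⁻¹ : ℂ) • (a + star a)‖ ≤ ‖a‖ := by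
    rw [norm_smul, show ‖(2⁻¹ : ℂ)‖ = 2⁻¹ by norm_num]
    have := norm_add_le a (star a)
    linarith
  have n2 : ‖(2⁻¹ * Complex.I : ℂ) • (star a - a)‖ ≤ ‖a‖ := by
    rw [norm_smul, show ‖(2⁻¹ * Complex.I : ℂ)‖ = 2⁻¹ by norm_num]
    have := norm_sub_le (star a) a
    linarith
  have m1 := hφ.norm_apply_le_of_isSelfAdjoint hS h1
  have m2 := hφ.norm_apply_le_of_isSelfAdjoint hS h2
  calc ‖φ a‖ = ‖φ ((2⁻¹ : ℂ) • (a + star a)) +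
        Complex.I * φ ((2⁻¹ * Complex.I : ℂ) • (star a - a))‖ := by
        conv_lhs => rw [h3, map_add, map_smul φ Complex.I, smul_eq_mul]
    _ ≤ _ := norm_add_le _ _
    _ ≤ _ := by
        rw [norm_mul, Complex.norm_I, one_mul]
        linarith

/-- The squared norm of a column with entries in `S`, with respect to the state `φ`. -/
def columnNormSq {m : ℕ} (φ : S →ₗ[ℂ] ℂ) (ξ : Fin m → S) : ℝ :=
  ∑ i, (φ (star (ξ i) * ξ i)).re

theorem IsFaithfulState.continuous_columnNormSq (hφ : IsFaithfulState φ)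
    (hS : IsClosed (S : Set (H →L[ℂ] H))) {m : ℕ} :
    Continuous (columnNormSq φ : (Fin m → S) → ℝ) := by
  have := hφ.continuous hS
  have hs : Continuous (star : S → S) :=
    Continuous.subtype_mk (continuous_star.comp continuous_subtype_val) _
  unfold columnNormSq
  fun_prop

theorem IsFaithfulState.columnNormSq_le (hφ : IsFaithfulState φ)
    (hS : IsClosed (S : Set (H →L[ℂ] H))) {m : ℕ} (X : Fin m → Fin m → S)
    (ξ : Fin m → S) :
    columnNormSq φ (fun i => ∑ j, X i j * ξ j) ≤
      ‖matrixOp fun i j => (X i j : H →L[ℂ] H)‖ ^ 2 * columnNormSq φ ξ := by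
  set M := matrixOp fun i j => (X i j : H →L[ℂ] H) with hM
  -- The argument of `φ` is a positive operator: paired with `v` it gives `‖M‖² ‖w‖² - ‖M w‖²`,
  -- where `w` has entries `ξ i v`.
  have h : 0 ≤ φ (((‖M‖ ^ 2 : ℝ) : ℂ) • ∑ i, star (ξ i) * ξ i -
      ∑ i, star (∑ j, X i j * ξ j) * ∑ j, X i j * ξ j) := by
    apply hφ.nonneg_of_nonneg hS
    rw [ContinuousLinearMap.nonneg_iff_isPositive, ContinuousLinearMap.isPositive_iff_complex]
    intro v
    have hin (a : S) : inner ℂ (((star a * a : S) : H →L[ℂ] H) v) v =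
        ((‖(a : H →L[ℂ] H) v‖ ^ 2 : ℝ) : ℂ) := by
      rw [MulMemClass.coe_mul, StarMemClass.coe_star, mul_apply_eq_comp,
        ContinuousLinearMap.star_eq_adjoint, ContinuousLinearMap.adjoint_inner_left]
      simp [inner_self_eq_norm_sq_to_K]
    let w : PiLp 2 (fun _ : Fin m => H) := WithLp.toLp 2 fun i => (ξ i : H →L[ℂ] H) v
    have hw : ‖w‖ ^ 2 = ∑ i, ‖(ξ i : H →L[ℂ] H) v‖ ^ 2 := by
      rw [PiLp.norm_sq_eq_of_L2]
    have hMw : ‖M w‖ ^ 2 = ∑ i, ‖((∑ j, X i j * ξ j : S) : H →L[ℂ] H) v‖ ^ 2 := by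
      rw [PiLp.norm_sq_eq_of_L2]
      refine Finset.sum_congr rfl fun i _ => ?_
      rw [show M w i = ∑ j, (X i j : H →L[ℂ] H) (w j) from matrixOp_apply _ w i]
      simp [w]
    have hval : inner ℂ (((((‖M‖ ^ 2 : ℝ) : ℂ) • ∑ i, star (ξ i) * ξ i -
        ∑ i, star (∑ j, X i j * ξ j) * ∑ j, X i j * ξ j : S) : H →L[ℂ] H) v) v =
        ((‖M‖ ^ 2 * ‖w‖ ^ 2 - ‖M w‖ ^ 2 : ℝ) : ℂ) := by
      have hcoe (z : ℂ) (a b : S) :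
          ((z • a - b : S) : H →L[ℂ] H) v = z • (a : H →L[ℂ] H) v - (b : H →L[ℂ] H) v := rfl
      rw [hw, hMw, hcoe, AddSubmonoidClass.coe_finsetSum, AddSubmonoidClass.coe_finsetSum,
        sum_apply, sum_apply, inner_sub_left, inner_smul_left, sum_inner, sum_inner]
      simp only [hin, Complex.conj_ofReal]
      push_cast
      rfl
    rw [hval]
    refine ⟨by simp only [RCLike.re_to_complex, Complex.ofReal_re], ?_⟩
    have := M.le_opNorm w
    simp only [RCLike.re_to_complex, Complex.ofReal_re]
    rw [← mul_pow, sub_nonneg]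
    gcongr
  rw [map_sub, map_smul, map_sum, map_sum, sub_nonneg, smul_eq_mul] at h
  have := (Complex.le_def.1 h).1
  rw [Complex.re_ofReal_mul, Complex.re_sum, Complex.re_sum] at this
  exact this

/-- If the spectrum of `T = M* M` exceeded `c`, a spectral cutoff of `T` above `c` would violate the
hypothesis. Faithfulness is what makes this cutoff visible to `φ`. -/
theorem IsFaithfulState.norm_matrixOp_sq_le (hφ : IsFaithfulState φ)
    (hS : IsClosed (S : Set (H →L[ℂ] H))) {m : ℕ} (X : Fin m → Fin m → S) {c : ℝ}
    (hc : 0 ≤ c)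
    (h : ∀ ξ, columnNormSq φ (fun i => ∑ j, X i j * ξ j) ≤ c * columnNormSq φ ξ) :
    ‖matrixOp fun i j => (X i j : H →L[ℂ] H)‖ ^ 2 ≤ c := by
  set M := matrixOp fun i j => (X i j : H →L[ℂ] H) with hM
  have hMe (i j : Fin m) : blockEntry i j M = X i j := blockEntry_matrixOp _ i j
  have hMS : M ∈ blockStarSubalgebra S m := fun i j => by rw [hMe]; exact (X i j).2
  set T := star M * M with hT
  have hT0 : 0 ≤ T := star_mul_self_nonneg M
  have hTsa : IsSelfAdjoint T := IsSelfAdjoint.of_nonneg hT0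
  have hTS : T ∈ blockStarSubalgebra S m := mul_mem (star_mem hMS) hMS
  -- With `g` the positive part of `t - c` and `f² = g`, one has `f² (t - c) = g²`. Applying the
  -- hypothesis to the columns of `f(T)` thus forces the columns of `g(T)` to have norm zero.
  let f : ℝ → ℝ := fun t => Real.sqrt (max (t - c) 0)
  let g : ℝ → ℝ := fun t => max (t - c) 0
  have hf : Continuous f := by fun_prop
  have hg : Continuous g := by fun_prop
  have hcl := isClosed_blockStarSubalgebra (m := m) hS
  have hfS : cfc f T ∈ blockStarSubalgebra S m := cfc_mem (hs := hcl) _ hTS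
  have hgS : cfc g T ∈ blockStarSubalgebra S m := cfc_mem (hs := hcl) _ hTS
  have hfsa : star (cfc f T) = cfc f T := (cfc_predicate f T : IsSelfAdjoint _)
  have hgsa : star (cfc g T) = cfc g T := (cfc_predicate g T : IsSelfAdjoint _)
  have hfT : star (M * cfc f T) * (M * cfc f T) - (c : ℂ) • (star (cfc f T) * cfc f T) =
      star (cfc g T) * cfc g T := by
    have e1 : star (M * cfc f T) * (M * cfc f T) = cfc f T * T * cfc f T := by
      rw [star_mul, hfsa, hT]; simp only [mul_assoc]
    have e2 : cfc f T * T * cfc f T = cfc (fun t => f t * t * f t) T := by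
      rw [cfc_mul (fun t => f t * t) f T, cfc_mul f (fun t => t) T, cfc_id' ℝ T]
    have e3 : (c : ℂ) • (cfc f T * cfc f T) = cfc (fun t => c * (f t * f t)) T := by
      rw [cfc_const_mul c (fun t => f t * f t) T, cfc_mul f f T]
      ext v i
      rfl
    rw [e1, hfsa, hgsa, e2, e3, ← cfc_sub (fun t => f t * t * f t) (fun t => c * (f t * f t)) T,
      ← cfc_mul g g T]
    refine cfc_congr fun t _ => ?_
    have : f t * f t = g t := Real.mul_self_sqrt (le_max_right _ _)
    have h2 : (t - c) * g t = g t * g t := by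
      simp only [g]
      rcases le_total (t - c) 0 with h | h <;> simp [h]
    linear_combination (t - c) * this + h2
  have hcol (Y : PiLp 2 (fun _ : Fin m => H) →L[ℂ] PiLp 2 (fun _ : Fin m => H))
      (hY : Y ∈ blockStarSubalgebra S m) (j : Fin m) (hj : blockEntry j j (star Y * Y) ∈ S) :
      columnNormSq φ (fun i => (⟨blockEntry i j Y, hY i j⟩ : S)) = (φ ⟨_, hj⟩).re := by
    rw [columnNormSq, ← Complex.re_sum, ← map_sum]
    congr 2
    ext1
    rw [AddSubmonoidClass.coe_finsetSum]
    simp only [blockEntry_mul, blockEntry_star]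
    rfl
  have hMf : M * cfc f T ∈ blockStarSubalgebra S m := mul_mem hMS hfS
  have hzero (j : Fin m) : columnNormSq φ (fun i => (⟨blockEntry i j (cfc g T), hgS i j⟩ : S)) ≤ 0 := by
    have h1 := h fun i => ⟨blockEntry i j (cfc f T), hfS i j⟩
    have h2 : (fun i => ∑ k, X i k * (⟨blockEntry k j (cfc f T), hfS k j⟩ : S)) =
        fun i => (⟨blockEntry i j (M * cfc f T), hMf i j⟩ : S) := by
      funext i
      ext1
      rw [AddSubmonoidClass.coe_finsetSum]
      simp only [blockEntry_mul, hMe]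
      rfl
    have m1 := mul_mem (star_mem hMf) hMf
    have m2 := mul_mem (star_mem hfS) hfS
    have m3 := mul_mem (star_mem hgS) hgS
    rw [h2, hcol _ hMf j (m1 j j), hcol _ hfS j (m2 j j)] at h1
    rw [hcol _ hgS j (m3 j j)]
    have h3 : (⟨_, m3 j j⟩ : S) = ⟨_, m1 j j⟩ - (c : ℂ) • ⟨_, m2 j j⟩ := by
      ext1
      change blockEntry j j _ = blockEntry j j _ - (c : ℂ) • blockEntry j j _
      rw [← hfT, blockEntry_sub, blockEntry_smul]
    rw [h3, map_sub, map_smul, smul_eq_mul, Complex.sub_re, Complex.re_ofReal_mul]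
    linarith
  have hg0 : cfc g T = 0 := by
    refine eq_zero_of_blockEntry_eq_zero fun i j => ?_
    have hp (i : Fin m) : 0 ≤ (φ (star (⟨blockEntry i j (cfc g T), hgS i j⟩ : S) *
        ⟨blockEntry i j (cfc g T), hgS i j⟩)).re := (Complex.le_def.1 (hφ.nonneg _)).1
    have h1 := (Finset.sum_eq_zero_iff_of_nonneg fun i _ => hp i).1
      (le_antisymm (hzero j) (Finset.sum_nonneg fun i _ => hp i)) i (Finset.mem_univ i)
    have h2 := (Complex.le_def.1
      (hφ.nonneg (⟨blockEntry i j (cfc g T), hgS i j⟩ : S))).2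
    exact congrArg Subtype.val (hφ.faithful _ (Complex.ext h1 h2.symm))
  have hle : T ≤ algebraMap ℝ _ c := by
    refine le_algebraMap_of_spectrum_le (fun t ht => ?_) hTsa
    have h1 : cfc g T = cfc (fun _ => (0 : ℝ)) T := by rw [hg0, cfc_const_zero]
    have h2 : g t = 0 := (cfc_eq_cfc_iff_eqOn hTsa hg.continuousOn continuousOn_const).1 h1 ht
    have h3 : t - c ≤ 0 := h2 ▸ le_max_left (t - c) 0
    linarith
  rw [sq, ← CStarRing.norm_star_mul_self, ← hT]
  exact (CStarAlgebra.norm_le_iff_le_algebraMap T hc hT0).2 hle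

end States

/-! ### Operator coefficients: semicircular and circular systems -/

section Systems

variable {ι H : Type*} [NormedAddCommGroup H] [InnerProductSpace ℂ H] {m : ℕ}

/-- The operator `∑ k, α k ⊗ x k` on `ℓ²_m(H)`. -/
def tensorSum [Fintype ι] (α : ι → Matrix (Fin m) (Fin m) ℂ) (x : ι → H →L[ℂ] H) :
    PiLp 2 (fun _ : Fin m => H) →L[ℂ] PiLp 2 (fun _ : Fin m => H) :=
  matrixOp (Matrix.of fun i j => ∑ k, α k i j • x k)

/-- The coefficients, with respect to `(a, b)`, of an operator with coefficients `α` with respect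
to `((a k + i b k) / √2)_k`. -/
def circularCoeff (α : ι → Matrix (Fin m) (Fin m) ℂ) : ι ⊕ ι → Matrix (Fin m) (Fin m) ℂ :=
  Sum.elim (fun k => (Real.sqrt 2 : ℂ)⁻¹ • α k)
    (fun k => ((Real.sqrt 2 : ℂ)⁻¹ * Complex.I) • α k)

theorem tensorSum_circular [Fintype ι] (α : ι → Matrix (Fin m) (Fin m) ℂ) (a b : ι → H →L[ℂ] H) :
    tensorSum α (fun k => ((Real.sqrt 2 : ℂ)⁻¹) • (a k + Complex.I • b k)) =
      tensorSum (circularCoeff α) (Sum.elim a b) := by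
  unfold tensorSum
  congr 1
  ext1 i j
  simp only [Matrix.of_apply, Fintype.sum_sum_type, circularCoeff, Sum.elim_inl, Sum.elim_inr,
    Matrix.smul_apply, ← Finset.sum_add_distrib, smul_add, smul_smul, smul_eq_mul]
  refine Finset.sum_congr rfl fun k _ => ?_
  congr 2 <;> ring

variable [CompleteSpace H]

theorem dense_wordMap_range [DecidableEq ι] {x : ι → H →L[ℂ] H} (hx : ∀ k, IsSelfAdjoint (x k)) :
    Dense (Set.range (wordMap fun k => (⟨x k, mem_generatedCStar x k⟩ : generatedCStar x))) := by
  set x' := fun k => (⟨x k, mem_generatedCStar x k⟩ : generatedCStar x) with hx'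
  rw [Subtype.dense_iff]
  refine closure_mono fun a ha => ?_
  have h1 : star (Set.range x) = Set.range x := by
    ext a
    constructor
    · rintro ⟨k, hk⟩
      exact ⟨k, by rw [← (hx k).star_eq, hk, star_star]⟩
    · rintro ⟨k, rfl⟩
      exact ⟨k, (hx k).star_eq.symm⟩
  have h2 : a ∈ Algebra.adjoin ℂ (Set.range x) := by
    have h3 : a ∈ (StarAlgebra.adjoin ℂ (Set.range x)).toSubalgebra := ha
    rwa [StarAlgebra.adjoin_toSubalgebra, h1, Set.union_self] at h3
  have h4 : Set.range x = (generatedCStar x).toSubalgebra.val '' Set.range x' := by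
    rw [← Set.range_comp]; rfl
  rw [h4, ← AlgHom.map_adjoin] at h2
  obtain ⟨b, hb, rfl⟩ := h2
  exact ⟨b, exists_wordMap_eq_of_mem_adjoin x' hb, rfl⟩

theorem isClosed_generatedCStar (x : ι → H →L[ℂ] H) :
    IsClosed (generatedCStar x : Set (H →L[ℂ] H)) :=
  StarSubalgebra.isClosed_topologicalClosure _

theorem columnNormSq_wordMap [DecidableEq ι] {S : StarSubalgebra ℂ (H →L[ℂ] H)}
    {φ : S →ₗ[ℂ] ℂ} (hφ : IsFaithfulState φ) {x : ι → S} (hx : IsSemicircularFamily φ x)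
    (F : Fin m → List ι →₀ ℂ) :
    columnNormSq φ (fun i => wordMap x (F i)) = wordNormSq F := by
  rw [columnNormSq, ← Complex.re_sum, hx.sum_apply_star_wordMap_mul hφ.map_one, Complex.ofReal_re]

variable [Fintype ι]

theorem columnNormSq_sum_mul_wordMap [DecidableEq ι] {S : StarSubalgebra ℂ (H →L[ℂ] H)}
    {φ : S →ₗ[ℂ] ℂ} (hφ : IsFaithfulState φ) {x : ι → S} (hx : IsSemicircularFamily φ x)
    (α : ι → Matrix (Fin m) (Fin m) ℂ) (F : Fin m → List ι →₀ ℂ) :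
    columnNormSq φ (fun i => ∑ j, (∑ k, α k i j • x k) * wordMap x (F j)) =
      wordNormSq (fockAction α F) := by
  rw [← columnNormSq_wordMap hφ hx]
  congr 1
  funext i
  rw [wordMap_fockAction, Finset.sum_comm]
  simp only [Finset.sum_mul, smul_mul_assoc]

theorem tensorSum_eq {S : StarSubalgebra ℂ (H →L[ℂ] H)} (α : ι → Matrix (Fin m) (Fin m) ℂ)
    (x : ι → S) : tensorSum α (fun k => (x k : H →L[ℂ] H)) =
      matrixOp fun i j => ((∑ k, α k i j • x k : S) : H →L[ℂ] H) := by
  unfold tensorSum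
  congr 1
  ext1 i j
  simp only [AddSubmonoidClass.coe_finsetSum]
  rfl

namespace IsSemicircularSystem

variable {x : ι → H →L[ℂ] H}

theorem norm_tensorSum_sq_le (hx : IsSemicircularSystem x) {α : ι → Matrix (Fin m) (Fin m) ℂ}
    {c : ℝ} (hc : 0 ≤ c) (h₁ : ColumnBound α c) (h₂ : RowBound α c) :
    ‖tensorSum α x‖ ^ 2 ≤ c := by
  classical
  obtain ⟨φ, hφ, hxφ⟩ := hx
  have hS := isClosed_generatedCStar x
  rw [show tensorSum α x = _ from
    tensorSum_eq α fun k => (⟨x k, mem_generatedCStar x k⟩ : generatedCStar x)]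
  refine hφ.norm_matrixOp_sq_le hS _ hc fun ξ => ?_
  have hsa (k : ι) : IsSelfAdjoint (x k) := (hxφ.selfAdjoint k).map (generatedCStar x).subtype
  have hd := dense_wordMap_range hsa
  have hd' := dense_pi (Set.univ : Set (Fin m)) fun _ _ => hd
  have hcont := hφ.continuous_columnNormSq hS (m := m)
  -- The inequality is closed in `ξ` by continuity of `φ`, so checking it on combinations of
  -- Chebyshev words, which are dense, is enough.
  refine closure_minimal (t := {ξ | columnNormSq φ (fun i => ∑ j, (∑ k, α k i j •
    (⟨x k, mem_generatedCStar x k⟩ : generatedCStar x)) * ξ j) ≤ c * columnNormSq φ ξ})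
    (fun ξ hξ => ?_) (isClosed_le ?_ (continuous_const.mul hcont)) (hd' ξ)
  · choose F hF using fun i => hξ i (Set.mem_univ i)
    obtain rfl : (fun i => wordMap _ (F i)) = ξ := funext hF
    rw [Set.mem_ofPred_eq, columnNormSq_sum_mul_wordMap hφ hxφ, columnNormSq_wordMap hφ hxφ]
    exact wordNormSq_fockAction_le hc h₁ h₂ F
  · refine hcont.comp (continuous_pi fun i => continuous_finsetSum _ fun j _ => ?_)
    exact continuous_const.mul (continuous_apply j)

theorem wordNormSq_fockAction_le_norm_tensorSum (hx : IsSemicircularSystem x)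
    (α : ι → Matrix (Fin m) (Fin m) ℂ) (F : Fin m → List ι →₀ ℂ) :
    wordNormSq (fockAction α F) ≤ ‖tensorSum α x‖ ^ 2 * wordNormSq F := by
  classical
  obtain ⟨φ, hφ, hxφ⟩ := hx
  rw [show tensorSum α x = _ from
    tensorSum_eq α fun k => (⟨x k, mem_generatedCStar x k⟩ : generatedCStar x),
    ← columnNormSq_sum_mul_wordMap hφ hxφ, ← columnNormSq_wordMap hφ hxφ]
  exact hφ.columnNormSq_le (isClosed_generatedCStar x) _ _

theorem columnBound (hx : IsSemicircularSystem x) (α : ι → Matrix (Fin m) (Fin m) ℂ) :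
    ColumnBound α (4 * ‖tensorSum α x‖ ^ 2) :=
  columnBound_of_wordNormSq_fockAction_le (hx.wordNormSq_fockAction_le_norm_tensorSum α)

theorem rowBound (hx : IsSemicircularSystem x) (α : ι → Matrix (Fin m) (Fin m) ℂ) :
    RowBound α (4 * ‖tensorSum α x‖ ^ 2) :=
  rowBound_of_wordNormSq_fockAction_le (hx.wordNormSq_fockAction_le_norm_tensorSum α)

end IsSemicircularSystem

/-! ### Passage from semicircular to circular systems -/

theorem norm_inv_sqrt_two_sq : ‖(Real.sqrt 2 : ℂ)⁻¹‖ ^ 2 = 2⁻¹ := by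
  rw [norm_inv, Complex.norm_real, Real.norm_eq_abs, inv_pow, sq_abs, Real.sq_sqrt (by norm_num)]

theorem sum_circularCoeff (α : ι → Matrix (Fin m) (Fin m) ℂ) (i : Fin m) (y : ι ⊕ ι → Fin m → ℂ) :
    ∑ k, ∑ j, circularCoeff α k i j * y k j = ∑ k, ∑ j, α k i j *
      ((Real.sqrt 2 : ℂ)⁻¹ * (y (Sum.inl k) j + Complex.I * y (Sum.inr k) j)) := by
  simp only [Fintype.sum_sum_type, circularCoeff, Sum.elim_inl, Sum.elim_inr, Matrix.smul_apply,
    ← Finset.sum_add_distrib, smul_eq_mul]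
  refine Finset.sum_congr rfl fun k _ => Finset.sum_congr rfl fun j _ => ?_
  ring

theorem columnBound_circularCoeff_iff {α : ι → Matrix (Fin m) (Fin m) ℂ} {c : ℝ} :
    ColumnBound (circularCoeff α) c ↔ ColumnBound α c := by
  refine forall_congr' fun v => ?_
  have h : ∑ k, ∑ i, ‖∑ j, circularCoeff α k i j * v j‖ ^ 2 =
      ∑ k, ∑ i, ‖∑ j, α k i j * v j‖ ^ 2 := by
    simp only [Fintype.sum_sum_type, circularCoeff, Sum.elim_inl, Sum.elim_inr,
      Matrix.smul_apply, smul_eq_mul, mul_assoc, ← Finset.mul_sum, norm_mul, mul_pow,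
      norm_inv_sqrt_two_sq, Complex.norm_I]
    ring
  rw [h]

/-- The new row is the old one composed with `(y, y') ↦ (y + i y') / √2`, which is a contraction. -/
theorem RowBound.circularCoeff {α : ι → Matrix (Fin m) (Fin m) ℂ} {c : ℝ} (hc : 0 ≤ c)
    (h : RowBound α c) : RowBound (circularCoeff α) c := by
  intro y
  simp only [sum_circularCoeff]
  refine (h _).trans ?_
  gcongr
  rw [Fintype.sum_sum_type, ← Finset.sum_add_distrib]
  refine Finset.sum_le_sum fun k _ => ?_
  rw [← Finset.sum_add_distrib]
  refine Finset.sum_le_sum fun j _ => ?_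
  rw [norm_mul, mul_pow, norm_inv_sqrt_two_sq]
  have h1 := norm_add_le (y (Sum.inl k) j) (Complex.I * y (Sum.inr k) j)
  rw [norm_mul, Complex.norm_I, one_mul] at h1
  nlinarith [norm_nonneg (y (Sum.inl k) j + Complex.I * y (Sum.inr k) j),
    sq_nonneg (‖y (Sum.inl k) j‖ - ‖y (Sum.inr k) j‖)]

theorem RowBound.of_circularCoeff {α : ι → Matrix (Fin m) (Fin m) ℂ} {c : ℝ}
    (h : RowBound (_root_.circularCoeff α) c) : RowBound α c := by
  intro z
  -- The pair `(z / √2, -i z / √2)` is an isometric lift of `z` through `(y, y') ↦ (y + i y') / √2`.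
  have h1 := h (Sum.elim (fun k j => (Real.sqrt 2 : ℂ)⁻¹ * z k j)
    (fun k j => -(Complex.I * ((Real.sqrt 2 : ℂ)⁻¹ * z k j))))
  have h2 : ((Real.sqrt 2 : ℂ)⁻¹) * (Real.sqrt 2 : ℂ)⁻¹ = 2⁻¹ := by
    rw [← mul_inv, ← Complex.ofReal_mul, Real.mul_self_sqrt (by norm_num)]; norm_num
  have h3 (w : ℂ) : (Real.sqrt 2 : ℂ)⁻¹ * ((Real.sqrt 2 : ℂ)⁻¹ * w +
      Complex.I * -(Complex.I * ((Real.sqrt 2 : ℂ)⁻¹ * w))) = w := by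
    linear_combination w * h2 * (1 - Complex.I ^ 2) - 2⁻¹ * w * Complex.I_sq
  simp only [sum_circularCoeff, Sum.elim_inl, Sum.elim_inr, h3] at h1
  refine h1.trans_eq ?_
  simp only [Fintype.sum_sum_type, Sum.elim_inl, Sum.elim_inr, norm_neg, norm_mul, mul_pow,
    norm_inv_sqrt_two_sq, Complex.norm_I, ← Finset.mul_sum]
  ring

/-- The norm equivalence common to semicircular and circular systems. -/
structure HasRowColumnNorms (x : ι → H →L[ℂ] H) : Prop where
  norm_tensorSum_sq_le : ∀ {m : ℕ} {α : ι → Matrix (Fin m) (Fin m) ℂ} {c : ℝ}, 0 ≤ c →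
    ColumnBound α c → RowBound α c → ‖tensorSum α x‖ ^ 2 ≤ c
  columnBound : ∀ {m : ℕ} (α : ι → Matrix (Fin m) (Fin m) ℂ),
    ColumnBound α (4 * ‖tensorSum α x‖ ^ 2)
  rowBound : ∀ {m : ℕ} (α : ι → Matrix (Fin m) (Fin m) ℂ), RowBound α (4 * ‖tensorSum α x‖ ^ 2)

theorem IsSemicircularSystem.hasRowColumnNorms {x : ι → H →L[ℂ] H}
    (hx : IsSemicircularSystem x) : HasRowColumnNorms x :=
  ⟨hx.norm_tensorSum_sq_le, hx.columnBound, hx.rowBound⟩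

theorem IsCircularSystem.hasRowColumnNorms {x : ι → H →L[ℂ] H}
    (hx : IsCircularSystem x) : HasRowColumnNorms x := by
  obtain ⟨a, b, hab, hx⟩ := hx
  obtain rfl : x = fun k => ((Real.sqrt 2 : ℂ)⁻¹) • (a k + Complex.I • b k) := funext hx
  refine ⟨fun {m α c} hc h₁ h₂ => ?_, fun {m} α => ?_, fun {m} α => ?_⟩ <;>
    rw [tensorSum_circular]
  · exact hab.norm_tensorSum_sq_le hc (columnBound_circularCoeff_iff.2 h₁) (h₂.circularCoeff hc)
  · exact columnBound_circularCoeff_iff.1 (hab.columnBound _)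
  · exact (hab.rowBound _).of_circularCoeff

theorem HasRowColumnNorms.linearIndependent {x : ι → H →L[ℂ] H} (hx : HasRowColumnNorms x) :
    LinearIndependent ℂ x := by
  rw [Fintype.linearIndependent_iff]
  intro c hc
  -- With scalar coefficients the column bound reads `∑ |c k|² ≤ 4 ‖∑ c k x k‖²`.
  have h := hx.columnBound (m := 1) (fun k => Matrix.of fun _ _ => c k) fun _ => 1
  have h0 : tensorSum (m := 1) (fun k => Matrix.of fun _ _ => c k) x = 0 := by
    ext v i
    rw [tensorSum, matrixOp_apply]
    simp [hc]
  rw [h0] at h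
  simp at h
  intro k
  have h1 := (Finset.sum_eq_zero_iff_of_nonneg fun k _ => by positivity).1
    (le_antisymm h (Finset.sum_nonneg fun k _ => by positivity)) k (Finset.mem_univ k)
  simpa using h1

end Systems

/-! ### The row and column space -/

section RowColumn

variable {m n : ℕ}

theorem rowColDelta_apply_inl (k i : Fin n) (v : EuclideanSpace ℂ (Fin n ⊕ Fin n)) :
    rowColDelta n k v (Sum.inl i) = if k = i then v (Sum.inl ⟨0, k.pos⟩) else 0 := by
  simp [rowColDelta, Matrix.mulVec, dotProduct, Matrix.single_apply, ite_and]

theorem rowColDelta_apply_inr (k i : Fin n) (v : EuclideanSpace ℂ (Fin n ⊕ Fin n)) :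
    rowColDelta n k v (Sum.inr i) = if ⟨0, k.pos⟩ = i then v (Sum.inr k) else 0 := by
  simp [rowColDelta, Matrix.mulVec, dotProduct, Matrix.single_apply, ite_and]

theorem tensorSum_rowColDelta_apply_inl (α : Fin n → Matrix (Fin m) (Fin m) ℂ)
    (v : PiLp 2 fun _ : Fin m => EuclideanSpace ℂ (Fin n ⊕ Fin n)) (i : Fin m) (k : Fin n) :
    tensorSum α (rowColDelta n) v i (Sum.inl k) =
      ∑ j, α k i j * v j (Sum.inl ⟨0, k.pos⟩) := by
  rw [tensorSum, matrixOp_apply]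
  simp [rowColDelta_apply_inl]

theorem tensorSum_rowColDelta_apply_inr (α : Fin n → Matrix (Fin m) (Fin m) ℂ)
    (v : PiLp 2 fun _ : Fin m => EuclideanSpace ℂ (Fin n ⊕ Fin n)) (i : Fin m) (k : Fin n) :
    tensorSum α (rowColDelta n) v i (Sum.inr k) =
      if ⟨0, k.pos⟩ = k then ∑ l, ∑ j, α l i j * v j (Sum.inr l) else 0 := by
  rw [tensorSum, matrixOp_apply, Finset.sum_comm]
  by_cases h : (⟨0, k.pos⟩ : Fin n) = k <;> simp [rowColDelta_apply_inr, h]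

theorem norm_sq_eq_sum_sum (v : PiLp 2 fun _ : Fin m => EuclideanSpace ℂ (Fin n ⊕ Fin n)) :
    ‖v‖ ^ 2 = ∑ k, ∑ j, ‖v j (Sum.inl k)‖ ^ 2 + ∑ k, ∑ j, ‖v j (Sum.inr k)‖ ^ 2 := by
  rw [PiLp.norm_sq_eq_of_L2]
  simp only [EuclideanSpace.norm_sq_eq, Fintype.sum_sum_type, Finset.sum_add_distrib]
  rw [Finset.sum_comm, Finset.sum_comm (s := (Finset.univ : Finset (Fin m)))]

theorem columnBound_of_rowColDelta (α : Fin n → Matrix (Fin m) (Fin m) ℂ) :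
    ColumnBound α (‖tensorSum α (rowColDelta n)‖ ^ 2) := by
  intro v
  rcases n with _ | n
  · simp
  -- The block `e_{k1}` sees only the first coordinate of the first summand, so all of `v` is placed
  -- there.
  let w : PiLp 2 fun _ : Fin m => EuclideanSpace ℂ (Fin (n + 1) ⊕ Fin (n + 1)) :=
    WithLp.toLp 2 fun j => EuclideanSpace.single (Sum.inl 0) (v j)
  have hw : ‖w‖ ^ 2 = ∑ j, ‖v j‖ ^ 2 := by
    rw [PiLp.norm_sq_eq_of_L2]
    simp [w]
  have h := (tensorSum α (rowColDelta (n + 1))).le_opNorm w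
  have h1 : ‖tensorSum α (rowColDelta (n + 1)) w‖ ^ 2 ≤
      (‖tensorSum α (rowColDelta (n + 1))‖ * ‖w‖) ^ 2 := by gcongr
  rw [mul_pow, hw, norm_sq_eq_sum_sum] at h1
  simp only [tensorSum_rowColDelta_apply_inl] at h1
  have h3 : 0 ≤ ∑ k, ∑ i, ‖tensorSum α (rowColDelta (n + 1)) w i (Sum.inr k)‖ ^ 2 :=
    Finset.sum_nonneg fun _ _ => Finset.sum_nonneg fun _ _ => sq_nonneg _
  refine le_trans (le_of_eq ?_) ((le_add_of_nonneg_right h3).trans h1)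
  refine Finset.sum_congr rfl fun k _ => Finset.sum_congr rfl fun i _ => ?_
  simp [w]

theorem rowBound_of_rowColDelta (α : Fin n → Matrix (Fin m) (Fin m) ℂ) :
    RowBound α (‖tensorSum α (rowColDelta n)‖ ^ 2) := by
  intro y
  rcases n with _ | n
  · simp
  let w : PiLp 2 fun _ : Fin m => EuclideanSpace ℂ (Fin (n + 1) ⊕ Fin (n + 1)) :=
    WithLp.toLp 2 fun j => WithLp.toLp 2 (Sum.elim 0 fun k => y k j)
  have hw : ‖w‖ ^ 2 = ∑ k, ∑ j, ‖y k j‖ ^ 2 := by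
    rw [norm_sq_eq_sum_sum]
    simp [w]
  have h := (tensorSum α (rowColDelta (n + 1))).le_opNorm w
  have h1 : ‖tensorSum α (rowColDelta (n + 1)) w‖ ^ 2 ≤
      (‖tensorSum α (rowColDelta (n + 1))‖ * ‖w‖) ^ 2 := by gcongr
  rw [mul_pow, hw, norm_sq_eq_sum_sum] at h1
  simp only [tensorSum_rowColDelta_apply_inr] at h1
  have h2 := Finset.single_le_sum (f := fun k : Fin (n + 1) => ∑ i, ‖if ⟨0, k.pos⟩ = k then
    ∑ l, ∑ j, α l i j * w j (Sum.inr l) else 0‖ ^ 2)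
    (fun k _ => Finset.sum_nonneg fun _ _ => sq_nonneg _) (Finset.mem_univ (0 : Fin (n + 1)))
  have h3 : 0 ≤ ∑ k, ∑ i, ‖tensorSum α (rowColDelta (n + 1)) w i (Sum.inl k)‖ ^ 2 :=
    Finset.sum_nonneg fun _ _ => Finset.sum_nonneg fun _ _ => sq_nonneg _
  refine le_trans (le_of_eq ?_) (h2.trans ((le_add_of_nonneg_left h3).trans h1))
  refine Finset.sum_congr rfl fun i _ => ?_
  simp [w]

theorem norm_tensorSum_rowColDelta_sq_le {α : Fin n → Matrix (Fin m) (Fin m) ℂ} {c : ℝ}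
    (hc : 0 ≤ c) (h₁ : ColumnBound α c) (h₂ : RowBound α c) :
    ‖tensorSum α (rowColDelta n)‖ ^ 2 ≤ c := by
  suffices h : ‖tensorSum α (rowColDelta n)‖ ≤ Real.sqrt c by
    calc _ ≤ Real.sqrt c ^ 2 := by gcongr
      _ = c := Real.sq_sqrt hc
  refine ContinuousLinearMap.opNorm_le_bound _ (Real.sqrt_nonneg c) fun v => ?_
  rw [← abs_of_nonneg (norm_nonneg (tensorSum α (rowColDelta n) v)),
    ← Real.sqrt_sq (norm_nonneg v), ← Real.sqrt_mul hc]
  refine Real.abs_le_sqrt ?_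
  rcases n with _ | n
  · rw [norm_sq_eq_sum_sum]
    simpa using mul_nonneg hc (sq_nonneg ‖v‖)
  rw [norm_sq_eq_sum_sum, norm_sq_eq_sum_sum, mul_add]
  simp only [tensorSum_rowColDelta_apply_inl, tensorSum_rowColDelta_apply_inr]
  refine add_le_add ((h₁ fun j => v j (Sum.inl 0)).trans ?_)
    (le_trans (le_of_eq ?_) (h₂ fun l j => v j (Sum.inr l)))
  · refine mul_le_mul_of_nonneg_left ?_ hc
    exact Finset.single_le_sum (f := fun k => ∑ j, ‖v j (Sum.inl k)‖ ^ 2)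
      (fun k _ => Finset.sum_nonneg fun _ _ => sq_nonneg _) (Finset.mem_univ (0 : Fin (n + 1)))
  · rw [Finset.sum_eq_single (0 : Fin (n + 1))]
    · simp
    · intro k _ hk
      simp [hk.symm]
    · simp

theorem linearIndependent_rowColDelta : LinearIndependent ℂ (rowColDelta n) := by
  rw [Fintype.linearIndependent_iff]
  intro c hc k
  have h := congrArg (fun T : EuclideanSpace ℂ (Fin n ⊕ Fin n) →L[ℂ] EuclideanSpace ℂ (Fin n ⊕ Fin n) =>
    T (EuclideanSpace.single (Sum.inl ⟨0, k.pos⟩) 1) (Sum.inl k)) hc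
  simpa [rowColDelta_apply_inl] using h

/-- Expanding the entries of a matrix over `E` in the basis turns it into `∑ α k ⊗ x k`, and its
image under `u` into `∑ α k ⊗ y k` with the same coefficients. -/
theorem cbNorm_le {H K : Type*} [NormedAddCommGroup H] [InnerProductSpace ℂ H]
    [NormedAddCommGroup K] [InnerProductSpace ℂ K]
    {x : Fin n → H →L[ℂ] H} {y : Fin n → K →L[ℂ] K}
    {E : Submodule ℂ (H →L[ℂ] H)} {F : Submodule ℂ (K →L[ℂ] K)} (u : E →ₗ[ℂ] F)
    (b : Module.Basis (Fin n) ℂ E) (hb : ∀ k, (b k : H →L[ℂ] H) = x k)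
    (hu : ∀ k, (u (b k) : K →L[ℂ] K) = y k) (C : ℝ)
    (h : ∀ {m : ℕ} (α : Fin n → Matrix (Fin m) (Fin m) ℂ), ‖tensorSum α x‖ ≤ 1 →
      ‖tensorSum α y‖ ≤ C) : cbNorm u ≤ ENNReal.ofReal C := by
  refine iSup_le fun m => iSup_le fun a => iSup_le fun ha => ?_
  let α : Fin n → Matrix (Fin m) (Fin m) ℂ := fun k => Matrix.of fun i j => b.repr (a i j) k
  have hx (i j : Fin m) : ((a i j : E) : H →L[ℂ] H) = ∑ k, α k i j • x k := by
    conv_lhs => rw [← b.sum_repr (a i j)]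
    simp only [Submodule.coe_sum, Submodule.coe_smul, hb]
    rfl
  have hy (i j : Fin m) : ((u (a i j) : F) : K →L[ℂ] K) = ∑ k, α k i j • y k := by
    conv_lhs => rw [← b.sum_repr (a i j), map_sum]
    simp only [map_smul, Submodule.coe_sum, Submodule.coe_smul, hu]
    rfl
  have h1 : matrixOp (fun i j => (a i j : H →L[ℂ] H)) = tensorSum α x :=
    congrArg matrixOp (funext fun i => funext fun j => hx i j)
  have h2 : matrixOp (fun i j => (u (a i j) : K →L[ℂ] K)) = tensorSum α y :=
    congrArg matrixOp (funext fun i => funext fun j => hy i j)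
  rw [h1] at ha
  rw [h2, ← ofReal_norm]
  exact ENNReal.ofReal_le_ofReal (h α ha)

end RowColumn

theorem Module.Basis.equiv_sum_smul {R ι M N : Type*} [Fintype ι] [CommSemiring R]
    [AddCommMonoid M] [Module R M] [AddCommMonoid N] [Module R N] (b : Module.Basis ι R M)
    (b' : Module.Basis ι R N) (c : ι → R) :
    b.equiv b' (Equiv.refl _) (∑ k, c k • b k) = ∑ k, c k • b' k := by
  simp

theorem proposition4p8 {H : Type*} [NormedAddCommGroup H] [InnerProductSpace ℂ H]
    [CompleteSpace H] (n : ℕ) (x : Fin n → H →L[ℂ] H)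
    (hx : IsSemicircularSystem x ∨ IsCircularSystem x) :
    ∃ u : rowColSpace n ≃ₗ[ℂ] Submodule.span ℂ (Set.range x),
      (∀ c : Fin n → ℂ,
        (u (∑ k, c k • rowColBasis n k) : H →L[ℂ] H) = ∑ k, c k • x k) ∧
      cbNorm (u : rowColSpace n →ₗ[ℂ] Submodule.span ℂ (Set.range x)) *
        cbNorm (u.symm : Submodule.span ℂ (Set.range x) →ₗ[ℂ] rowColSpace n) ≤ 2 := by
  have hn : HasRowColumnNorms x :=
    hx.elim IsSemicircularSystem.hasRowColumnNorms IsCircularSystem.hasRowColumnNorms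
  let bE : Module.Basis (Fin n) ℂ (rowColSpace n) := Module.Basis.span linearIndependent_rowColDelta
  let bF : Module.Basis (Fin n) ℂ (Submodule.span ℂ (Set.range x)) :=
    Module.Basis.span hn.linearIndependent
  have hE (k : Fin n) : (bE k : EuclideanSpace ℂ (Fin n ⊕ Fin n) →L[ℂ] _) = rowColDelta n k :=
    Module.Basis.coe_span_apply _ k
  have hF (k : Fin n) : (bF k : H →L[ℂ] H) = x k := Module.Basis.coe_span_apply _ k
  have hE' (k : Fin n) : rowColBasis n k = bE k := Subtype.ext (hE k).symm
  let u := bE.equiv bF (Equiv.refl _)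
  have hu (k : Fin n) : u (bE k) = bF k := bE.equiv_apply k bF (Equiv.refl _)
  have hu' (k : Fin n) : u.symm (bF k) = bE k := by rw [← hu, u.symm_apply_apply]
  refine ⟨u, fun c => ?_, ?_⟩
  · simp only [hE']
    rw [Module.Basis.equiv_sum_smul]
    simp only [Submodule.coe_sum, Submodule.coe_smul, hF]
  have h1 : cbNorm (u : rowColSpace n →ₗ[ℂ] Submodule.span ℂ (Set.range x)) ≤
      ENNReal.ofReal 1 := by
    refine cbNorm_le (x := rowColDelta n) (y := x) _ bE hE (fun k => ?_) 1 fun α hα => ?_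
    · rw [← hF, ← hu]; rfl
    · have h := hn.norm_tensorSum_sq_le (sq_nonneg _) (columnBound_of_rowColDelta α)
        (rowBound_of_rowColDelta α)
      exact ((pow_le_pow_iff_left₀ (norm_nonneg _) (norm_nonneg _) two_ne_zero).1 h).trans hα
  have h2 : cbNorm (u.symm : Submodule.span ℂ (Set.range x) →ₗ[ℂ] rowColSpace n) ≤
      ENNReal.ofReal 2 := by
    refine cbNorm_le (x := x) (y := rowColDelta n) _ bF hF (fun k => ?_) 2 fun α hα => ?_
    · rw [← hE, ← hu']; rfl
    · have h := norm_tensorSum_rowColDelta_sq_le (by positivity) (hn.columnBound α)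
        (hn.rowBound α)
      nlinarith [norm_nonneg (tensorSum α x), norm_nonneg (tensorSum α (rowColDelta n))]
  calc _ ≤ ENNReal.ofReal 1 * ENNReal.ofReal 2 := mul_le_mul' h1 h2
    _ = 2 := by norm_num

end
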